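/- Consider the linear system $x_{k+1}=Ax_k+Bu_k+w_k$, $y_k=Cx_k+Du_k+v_k$ with $A\in\mathbb R^{n\times n}$, $B\in\mathbb R^{n\times p}$, $C\in\mathbb R^{m\times n}$, $D\in\mathbb R^{m\times p}$, $n\ge 1$, $(A,C)$ observable and $(A,B)$ controllable. One observes $N$ independent trajectories $(u^{(i)}_k,y^{(i)}_k)_{0\le k\le K-1}$, $1\le i\le N$, each started at $x^{(i)}_0=0$, where the inputs $u_k^{(i)}\sim\mathcal N(0,\sigma_u^2 I_p)$, the process noises $w_k^{(i)}\sim\mathcal N(0,\sigma_w^2I_n)$ and the measurement noises $v_k^{(i)}\sim\mathcal N(0,\sigma_v^2I_m)$ ($\sigma_u,\sigma_w,\sigma_v>0$) are i.i.d. over $k$ and $i$ and mutually independent. Let $K=K_1+K_2+1$ with $K_1,K_2\ge n$. Write $\|\cdot\|$ for the spectral norm, $\sigma_j(\cdot)$ for the $j$-th largest singular value, and put $$G=[D\;\;CB\;\;CAB\;\cdots\;CA^{K-2}B],\qquad F=[0\;\;C\;\;CA\;\cdots\;CA^{K-2}].$$ Let $\widehat G$ be a minimizer of $\|Y-XU\|_{\rm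 F}^2$ over $X\in\mathbb R^{m\times Kp}$, where $Y=[y^{(1)}\cdots y^{(N)}]$ with $y^{(i)}=[y_0^{(i)}\cdots y_{K-1}^{(i)}]$ and $U=[U^{(1)}\cdots U^{(N)}]$, $U^{(i)}$ being the block upper triangular Toeplitz matrix whose $(l,k)$ block ($0\le l,k\le K-1$) is $u^{(i)}_{k-l}$ for $l\le k$ and $0$ for $l>k$. The Ho-Kalman algorithm with input $G=[G_0\;G_1\cdots G_{K-1}]$ forms the block Hankel matrix $H=(G_{i+j+1})_{0\le i<K_1,\,0\le j\le K_2}$; deletes its right-most, respectively left-most, block column to get $H^-$, respectively $H^+$; takes a best approximation $L$ of $H^-$ of rank at most $n$ in spectral norm, a singular value decomposition $L=\mathcal U_1\Sigma_1\mathcal V_1^\top$ with $n$ singular values in descending order, $O=\mathcal U_1\Sigma_1^{1/2}$ and $Q=\Sigma_1^{1/2}\mathcal V_1^\top$; and returns the state matrix $O^\dagger H^+Q^\dagger$ ($\dagger$: Moore-Penrose inverse). Let $L,\overline A$ be the matrices it produces from the true $G$, and $\widehat L,\widehat A$ those it produces from $\widehat G$ (for any choice of the approximations and decompositions); $H^\pm$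 belong to the true $G$. For $0<\delta<1$ let $$C_1=8\sqrt{2K(K+1)(p+m)\log(27K/\delta)},\qquad C_2=16\|F\|\sqrt{\Big(\tfrac{K^3}{3}+\tfrac{K^2}{2}+\tfrac K6\Big)2(p+n)\log(27K/\delta)},$$ $$\varepsilon_N=\frac{\sigma_vC_1+\sigma_wC_2}{\sigma_u}\sqrt{\frac1N},\qquad \Delta'=\frac{9\sqrt n}{\sigma_n(H^-)}\Big(\frac{\|H^+\|}{\sigma_n(H^-)}+2\Big)\sqrt{\min\{K_1,K_2+1\}}\;\varepsilon_N .$$ Theorem. Fix $0<\delta<1$. (1) If $N\ge 8pK+4(p+n+m+4)\log(3K/\delta)$, then there is an event of probability at least $1-\delta$ on which the following holds: if the perturbation condition $\|L-\widehat L\|\le\sigma_n(H^-)/2$ is satisfied, or if $N$ is so large that $4\sqrt{\min\{K_1,K_2\}}\,\varepsilon_N\le\sigma_n(H^-)$, then the Hausdorff distance $d_{\rm H}(\widehat A,\overline A)$ between the (complex) spectra of $\widehat A$ and $\overline A$ satisfies $$d_{\rm H}(\widehat A,\overline A)\le(\Delta'+2\|\overline A\|)^{1-\frac1n}(\Delta')^{\frac1n}.$$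 (2) Consequently the error decays like $O(N^{-1/(2n)})$: there are $c$ and $N_0$, depending only on $A,B,C,D$, $K_1,K_2$, $\sigma_u,\sigma_w,\sigma_v$ and $\delta$, such that for every $N\ge N_0$, with probability at least $1-\delta$, $d_{\rm H}(\widehat A,\overline A)\le c\,N^{-1/(2n)}$. -/

import Mathlib

open MeasureTheory ProbabilityTheory
-- `‖M‖` for a real matrix `M` is the spectral norm (largest singular value).
open scoped Matrix Matrix.Norms.L2Operator

universe u

namespace PoleEstimation

noncomputable section

/-- The `j`-th largest singular value `σ_j(M)`, with `j = 1, 2, …`. -/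
def sigma {ι κ : Type*} [Fintype ι] [Fintype κ] [DecidableEq ι] [DecidableEq κ]
    (j : ℕ) (M : Matrix ι κ ℝ) : ℝ :=
  (Matrix.toEuclideanLin M).singularValues (j - 1)

/-! ### The linear system -/

/-- `(A, B)` is controllable: `[B, AB, …, A^{n-1}B]` has rank `n`. -/
def IsControllable {n p : ℕ} (A : Matrix (Fin n) (Fin n) ℝ) (B : Matrix (Fin n) (Fin p) ℝ) :
    Prop :=
  (Matrix.of fun (a : Fin n) (kb : Fin n × Fin p) => (A ^ (kb.1 : ℕ) * B) a kb.2).rank = n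

/-- `(A, C)` is observable: the matrix with block rows `C, CA, …, CA^{n-1}` has rank `n`. -/
def IsObservable {n m : ℕ} (A : Matrix (Fin n) (Fin n) ℝ) (C : Matrix (Fin m) (Fin n) ℝ) :
    Prop :=
  (Matrix.of fun (ka : Fin n × Fin m) (b : Fin n) => (C * A ^ (ka.1 : ℕ)) ka.2 b).rank = n

/-- `G = [D, CB, CAB, …, CA^{K-2}B]`; columns are indexed by (block, column in the block). -/
def markov {n m p : ℕ} (K : ℕ) (A : Matrix (Fin n) (Fin n) ℝ) (B : Matrix (Fin n) (Fin p) ℝ)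
    (C : Matrix (Fin m) (Fin n) ℝ) (D : Matrix (Fin m) (Fin p) ℝ) :
    Matrix (Fin m) (Fin K × Fin p) ℝ :=
  Matrix.of fun a kb =>
    if (kb.1 : ℕ) = 0 then D a kb.2 else (C * A ^ ((kb.1 : ℕ) - 1) * B) a kb.2

/-- `F = [0, C, CA, …, CA^{K-2}]`. -/
def noiseMarkov {n m : ℕ} (K : ℕ) (A : Matrix (Fin n) (Fin n) ℝ)
    (C : Matrix (Fin m) (Fin n) ℝ) : Matrix (Fin m) (Fin K × Fin n) ℝ :=
  Matrix.of fun a kb =>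
    if (kb.1 : ℕ) = 0 then 0 else (C * A ^ ((kb.1 : ℕ) - 1)) a kb.2

/-! ### The experiment: `N` independent trajectories of length `K` -/

/-- `N` trajectories of length `K` of the system
`x_{k+1} = A x_k + B u_k + w_k`, `y_k = C x_k + D u_k + v_k`, started at `x_0 = 0`, where
`u_k ~ N(0, σ_u² I)`, `w_k ~ N(0, σ_w² I)`, `v_k ~ N(0, σ_v² I)` are independent over all times and
trajectories, and the three families are mutually independent. -/
structure IsExperiment {n m p N K : ℕ} {Ω : Type*} [MeasurableSpace Ω] (P : Measure Ω)
    (A : Matrix (Fin n) (Fin n) ℝ) (B : Matrix (Fin n) (Fin p) ℝ)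
    (C : Matrix (Fin m) (Fin n) ℝ) (D : Matrix (Fin m) (Fin p) ℝ) (σu σw σv : ℝ)
    (u : Fin N → Fin K → Ω → EuclideanSpace ℝ (Fin p))
    (w : Fin N → Fin K → Ω → EuclideanSpace ℝ (Fin n))
    (v : Fin N → Fin K → Ω → EuclideanSpace ℝ (Fin m))
    (x : Fin N → Fin (K + 1) → Ω → (Fin n → ℝ))
    (y : Fin N → Fin K → Ω → (Fin m → ℝ)) : Prop where
  input_law : ∀ i k, HasLaw (u i k) (multivariateGaussian 0 (σu ^ 2 • (1 : Matrix _ _ ℝ))) P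
  process_law : ∀ i k, HasLaw (w i k) (multivariateGaussian 0 (σw ^ 2 • (1 : Matrix _ _ ℝ))) P
  meas_law : ∀ i k, HasLaw (v i k) (multivariateGaussian 0 (σv ^ 2 • (1 : Matrix _ _ ℝ))) P
  input_indep : iIndepFun (fun q : Fin N × Fin K => u q.1 q.2) P
  process_indep : iIndepFun (fun q : Fin N × Fin K => w q.1 q.2) P
  meas_indep : iIndepFun (fun q : Fin N × Fin K => v q.1 q.2) P
  /-- The process noise is independent of the measurement noise … -/
  noise_indep : IndepFun (fun ω (q : Fin N × Fin K) => w q.1 q.2 ω)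
    (fun ω (q : Fin N × Fin K) => v q.1 q.2 ω) P
  /-- … and the input is independent of the two noises jointly. -/
  input_noise_indep : IndepFun (fun ω (q : Fin N × Fin K) => u q.1 q.2 ω)
    (fun ω => ((fun (q : Fin N × Fin K) => w q.1 q.2 ω),
      (fun (q : Fin N × Fin K) => v q.1 q.2 ω))) P
  init : ∀ i ω, x i 0 ω = 0
  state_eq : ∀ i (k : Fin K) ω,
    x i k.succ ω = A *ᵥ x i k.castSucc ω + B *ᵥ (u i k ω).ofLp + (w i k ω).ofLp
  output_eq : ∀ i (k : Fin K) ω,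
    y i k ω = C *ᵥ x i k.castSucc ω + D *ᵥ (u i k ω).ofLp + (v i k ω).ofLp

/-- `Y = [y^{(1)}, …, y^{(N)}]`, `y^{(i)} = [y_0^{(i)}, …, y_{K-1}^{(i)}]`. -/
def outputMatrix {m N K : ℕ} (y : Fin N → Fin K → (Fin m → ℝ)) :
    Matrix (Fin m) (Fin N × Fin K) ℝ :=
  Matrix.of fun a ik => y ik.1 ik.2 a

/-- `U = [U^{(1)}, …, U^{(N)}]`, where `U^{(i)}` is block upper triangular Toeplitz: its block in
block row `l` and column `k` is `u_{k-l}^{(i)}` for `l ≤ k` and `0` otherwise. -/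
def inputMatrix {p N K : ℕ} (u : Fin N → Fin K → EuclideanSpace ℝ (Fin p)) :
    Matrix (Fin K × Fin p) (Fin N × Fin K) ℝ :=
  Matrix.of fun lb ik =>
    if lb.1 ≤ ik.2 then
      u ik.1 ⟨(ik.2 : ℕ) - (lb.1 : ℕ), lt_of_le_of_lt (Nat.sub_le _ _) ik.2.isLt⟩ lb.2
    else 0

/-- `Ghat` minimizes `‖Y - X U‖_F²` over all `X`. -/
def IsLeastSquares {ι κ τ : Type*} [Fintype ι] [Fintype κ] [Fintype τ]
    (Y : Matrix ι τ ℝ) (U : Matrix κ τ ℝ) (Ghat : Matrix ι κ ℝ) : Prop :=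
  ∀ X : Matrix ι κ ℝ,
    ∑ a, ∑ t, (Y - Ghat * U) a t ^ 2 ≤ ∑ a, ∑ t, (Y - X * U) a t ^ 2

/-! ### The Ho-Kalman algorithm -/

/-- The block Hankel matrix of `G = [G_0, G_1, …]`: block `(i, j)` is `G_{i+j+1}`, for
`0 ≤ i < K₁` and `0 ≤ j ≤ K₂`. -/
def hankel {m p K₁ K₂ : ℕ} (G : Matrix (Fin m) (Fin (K₁ + K₂ + 1) × Fin p) ℝ) :
    Matrix (Fin K₁ × Fin m) (Fin (K₂ + 1) × Fin p) ℝ :=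
  Matrix.of fun ia jb =>
    G ia.2 (⟨(ia.1 : ℕ) + (jb.1 : ℕ) + 1, by have := ia.1.isLt; have := jb.1.isLt; omega⟩, jb.2)

/-- `H⁻`: the Hankel matrix without its right-most block column. -/
def hankelMinus {m p K₁ K₂ : ℕ} (G : Matrix (Fin m) (Fin (K₁ + K₂ + 1) × Fin p) ℝ) :
    Matrix (Fin K₁ × Fin m) (Fin K₂ × Fin p) ℝ :=
  (hankel G).submatrix id fun jb => (jb.1.castSucc, jb.2)

/-- `H⁺`: the Hankel matrix without its left-most block column. -/
def hankelPlus {m p K₁ K₂ : ℕ} (G : Matrix (Fin m) (Fin (K₁ + K₂ + 1) × Fin p) ℝ) :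
    Matrix (Fin K₁ × Fin m) (Fin K₂ × Fin p) ℝ :=
  (hankel G).submatrix id fun jb => (jb.1.succ, jb.2)

/-- `L` is a best approximation of `M` (in spectral norm) among matrices of rank at most `r`. -/
def IsBestRankApprox {ι κ : Type*} [Fintype ι] [Fintype κ] [DecidableEq ι] [DecidableEq κ]
    (r : ℕ) (M L : Matrix ι κ ℝ) : Prop :=
  L.rank ≤ r ∧ ∀ X : Matrix ι κ ℝ, X.rank ≤ r → ‖M - L‖ ≤ ‖M - X‖

/-- `X` is the Moore-Penrose inverse of `M`. -/
def IsMoorePenrose {ι κ : Type*} [Fintype ι] [Fintype κ]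
    (M : Matrix ι κ ℝ) (X : Matrix κ ι ℝ) : Prop :=
  M * X * M = M ∧ X * M * X = X ∧ (M * X)ᵀ = M * X ∧ (X * M)ᵀ = X * M

/-- `O = 𝒰 Σ^{1/2}` and `Q = Σ^{1/2} 𝒱ᵀ` for a singular value decomposition `L = 𝒰 Σ 𝒱ᵀ` with `n`
singular values in descending order. -/
def IsBalancedFactorization {ι κ : Type*} [Fintype ι] [Fintype κ] (n : ℕ) (L : Matrix ι κ ℝ)
    (O : Matrix ι (Fin n) ℝ) (Q : Matrix (Fin n) κ ℝ) : Prop :=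
  ∃ (U : Matrix ι (Fin n) ℝ) (s : Fin n → ℝ) (V : Matrix κ (Fin n) ℝ),
    Uᵀ * U = 1 ∧ Vᵀ * V = 1 ∧ Antitone s ∧ (∀ i, 0 ≤ s i) ∧
    L = U * Matrix.diagonal s * Vᵀ ∧
    O = U * Matrix.diagonal (fun i => Real.sqrt (s i)) ∧
    Q = Matrix.diagonal (fun i => Real.sqrt (s i)) * Vᵀ

/-- A run of the Ho-Kalman algorithm of order `n` on the input `G` may produce the rank-`n`
matrix `L` and the state matrix `A = O† H⁺ Q†`. (A relation, because the singular value
decomposition is not unique.) -/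
def IsHoKalmanOutput {n m p K₁ K₂ : ℕ} (G : Matrix (Fin m) (Fin (K₁ + K₂ + 1) × Fin p) ℝ)
    (L : Matrix (Fin K₁ × Fin m) (Fin K₂ × Fin p) ℝ) (A : Matrix (Fin n) (Fin n) ℝ) : Prop :=
  IsBestRankApprox n (hankelMinus G) L ∧
  ∃ (O : Matrix (Fin K₁ × Fin m) (Fin n) ℝ) (Q : Matrix (Fin n) (Fin K₂ × Fin p) ℝ)
    (O' : Matrix (Fin n) (Fin K₁ × Fin m) ℝ) (Q' : Matrix (Fin K₂ × Fin p) (Fin n) ℝ),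
    IsBalancedFactorization n L O Q ∧ IsMoorePenrose O O' ∧ IsMoorePenrose Q Q' ∧
    A = O' * hankelPlus G * Q'

/-! ### The error bound -/

/-- The Hausdorff distance between the (complex) spectra of two real square matrices. -/
def spectralDist {n : ℕ} (M M' : Matrix (Fin n) (Fin n) ℝ) : ℝ :=
  Metric.hausdorffDist (spectrum ℂ (M.map (algebraMap ℝ ℂ)))
    (spectrum ℂ (M'.map (algebraMap ℝ ℂ)))

/-- `C₁ = 8 √(2 K (K+1) (p+m) log(27K/δ))`. -/
def constOne (m p K : ℕ) (δ : ℝ) : ℝ :=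
  8 * Real.sqrt (2 * K * (K + 1) * (p + m) * Real.log (27 * K / δ))

/-- `C₂ = 16 ‖F‖ √((K³/3 + K²/2 + K/6) · 2 (p+n) log(27K/δ))`, with `f = ‖F‖`. -/
def constTwo (n p K : ℕ) (f δ : ℝ) : ℝ :=
  16 * f * Real.sqrt (((K : ℝ) ^ 3 / 3 + (K : ℝ) ^ 2 / 2 + (K : ℝ) / 6) * (2 * (p + n)) *
    Real.log (27 * K / δ))

/-- `(σ_v C₁ + σ_w C₂) / σ_u · √(1/N)`. -/
def markovError {n m : ℕ} (p K N : ℕ) (A : Matrix (Fin n) (Fin n) ℝ)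
    (C : Matrix (Fin m) (Fin n) ℝ) (σu σw σv δ : ℝ) : ℝ :=
  (σv * constOne m p K δ + σw * constTwo n p K ‖noiseMarkov K A C‖ δ) / σu *
    Real.sqrt (1 / N)

/-- `Δ'`. -/
def poleDelta {n m p : ℕ} (K₁ K₂ N : ℕ) (A : Matrix (Fin n) (Fin n) ℝ)
    (B : Matrix (Fin n) (Fin p) ℝ) (C : Matrix (Fin m) (Fin n) ℝ) (D : Matrix (Fin m) (Fin p) ℝ)
    (σu σw σv δ : ℝ) : ℝ :=
  let G := markov (K₁ + K₂ + 1) A B C D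
  9 * Real.sqrt n / sigma n (hankelMinus G) *
    (‖hankelPlus G‖ / sigma n (hankelMinus G) + 2) *
    Real.sqrt (min K₁ (K₂ + 1) : ℕ) *
    markovError p (K₁ + K₂ + 1) N A C σu σw σv δ

end

end PoleEstimation

/-!
The proof has a deterministic part and a probabilistic part; they meet in the inequality
`√K ‖Ĝ - G‖ ≤ ε_N`, where `K = K₁ + K₂ + 1` and `ε_N` is `markovError`.

*From Markov parameters to poles.* Passing from `G` to `H⁻` or `H⁺` costs a factor `√K₁` in
spectral norm, because every block row of a Hankel matrix is a submatrix of `G`; so the Hankel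
matrices of `Ĝ` and `G` differ by at most `ε_N`. Observability and controllability make `H⁻` a
matrix of rank exactly `n`, hence `L = H⁻` and `‖L - L̂‖ ≤ 2 ε_N`. The matrices `Ô` and `Q̂` need
not be close to `O` and `Q`, since the singular value decompositions may be chosen independently;
but with `T = Q̂ Q†` the matrix `Ô T` is near `O` and `Q̂† T` is near `Q†`, so that `T⁻¹ Â T` is
near `Ā` (`exists_similar_state_near`). The spectrum does not change under similarity, and
Elsner's theorem bounds the Hausdorff distance of two spectra by
`(‖M‖ + ‖M'‖)^(1-1/n) ‖M - M'‖^(1/n)` (`spectralDist_le`): if `M' x = μ x` with `‖x‖ = 1`, then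
`|det (M - μ)| ≤ ‖(M - μ) x‖ ‖M - μ‖^(n-1) ≤ ‖M - M'‖ (‖M‖ + ‖M'‖)^(n-1)`, and some eigenvalue of
`M` is within the `n`-th root of `|det (M - μ)|` of `μ`. Together this is
`hoKalman_spectralDist_le`.

*From data to Markov parameters.* The outputs satisfy `Y = G U + (F W + V)`, so that if `U` has
full row rank, then `Ĝ - G = (F W + V) U†` with `U† = Uᵀ (U Uᵀ)⁻¹`. The last column of each
Toeplitz block of `U` holds all inputs of one trajectory, so these columns are independent
Gaussian vectors, and already they give `‖Uᵀ x‖ ≥ σ_u √N ‖x‖ / 5` with high probability: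
chi-square tail bounds hold for every `x` in a finite net of the unit sphere
(`measure_lastColumns`). The inputs being independent of the noises, one may condition on `U`;
then `s ⬝ V U† t` and `s ⬝ W U† t` are centred Gaussian, with variances at most
`25 σ_v² / (σ_u² N)` and `25 K σ_w² / (σ_u² N)` for unit vectors `s` and `t`. A union bound over
two nets turns this into bounds on the spectral norms (`measure_norm_gt_le`). The three failure
probabilities are `δ / 3` each, which gives `IsExperiment.measure_estimation`.

For the rate, `Δ'` is a constant times `N^(-1/2)`, and the condition
`4 √(min K₁ K₂) ε_N ≤ σ_n(H⁻)` holds for large `N` because `σ_n(H⁻) > 0`.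
-/

namespace PoleEstimation

/-! ### The spectral norm through Euclidean lengths -/

section Norms

variable {𝕜 : Type*} [RCLike 𝕜] {ι κ : Type*} [Fintype ι] [Fintype κ]

/-- The Euclidean length of a coordinate vector. (The norm that `ι → 𝕜` carries in Mathlib is the
maximum norm.) -/
noncomputable def vnorm (x : ι → 𝕜) : ℝ := ‖WithLp.toLp 2 x‖

lemma vnorm_nonneg (x : ι → 𝕜) : 0 ≤ vnorm x := norm_nonneg _

@[simp] lemma vnorm_zero : vnorm (0 : ι → 𝕜) = 0 := by simp [vnorm]

lemma vnorm_eq_zero {x : ι → 𝕜} : vnorm x = 0 ↔ x = 0 := by simp [vnorm]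

lemma vnorm_add_le (x y : ι → 𝕜) : vnorm (x + y) ≤ vnorm x + vnorm y := by
  simpa [vnorm] using norm_add_le (WithLp.toLp 2 x) (WithLp.toLp 2 y)

lemma vnorm_sub_le (x y : ι → 𝕜) : vnorm (x - y) ≤ vnorm x + vnorm y := by
  simpa [vnorm] using norm_sub_le (WithLp.toLp 2 x) (WithLp.toLp 2 y)

lemma vnorm_smul (c : 𝕜) (x : ι → 𝕜) : vnorm (c • x) = ‖c‖ * vnorm x := by
  simpa [vnorm] using norm_smul c (WithLp.toLp 2 x)

lemma vnorm_sq_eq_sum (x : ι → 𝕜) : vnorm x ^ 2 = ∑ i, ‖x i‖ ^ 2 := by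
  simp [vnorm, EuclideanSpace.norm_sq_eq]

lemma vnorm_sq (x : ι → ℝ) : vnorm x ^ 2 = x ⬝ᵥ x := by
  rw [vnorm_sq_eq_sum]
  simp [dotProduct, sq]

lemma dotProduct_le_vnorm (x y : ι → ℝ) : x ⬝ᵥ y ≤ vnorm x * vnorm y := by
  have := real_inner_le_norm (WithLp.toLp 2 y) (WithLp.toLp 2 x)
  simpa [vnorm, EuclideanSpace.inner_toLp_toLp, mul_comm] using this

variable [DecidableEq κ]

lemma vnorm_mulVec_le (A : Matrix ι κ 𝕜) (x : κ → 𝕜) : vnorm (A *ᵥ x) ≤ ‖A‖ * vnorm x :=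
  Matrix.l2_opNorm_mulVec A (WithLp.toLp 2 x)

lemma norm_le_of_vnorm_mulVec {A : Matrix ι κ 𝕜} {r : ℝ} (hr : 0 ≤ r)
    (h : ∀ x, vnorm (A *ᵥ x) ≤ r * vnorm x) : ‖A‖ ≤ r := by
  rw [Matrix.l2_opNorm_def]
  exact ContinuousLinearMap.opNorm_le_bound _ hr fun x => h x.ofLp

lemma norm_transpose [DecidableEq ι] (A : Matrix ι κ ℝ) : ‖Aᵀ‖ = ‖A‖ := by
  rw [← Matrix.conjTranspose_eq_transpose_of_trivial, Matrix.l2_opNorm_conjTranspose]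

end Norms

/-! ### Moore-Penrose inverses -/

section Pinv

variable {ι κ : Type*} [Fintype ι] [Fintype κ]

/-- An orthogonal projection is a contraction. -/
lemma norm_le_one_of_symm_idem [DecidableEq ι] {S : Matrix ι ι ℝ} (hs : Sᵀ = S) (hi : S * S = S) :
    ‖S‖ ≤ 1 := by
  refine norm_le_of_vnorm_mulVec zero_le_one fun x => ?_
  have h : vnorm (S *ᵥ x) ^ 2 ≤ vnorm x * vnorm (S *ᵥ x) := by
    calc vnorm (S *ᵥ x) ^ 2 = x ⬝ᵥ S *ᵥ x := by
          rw [vnorm_sq, Matrix.dotProduct_mulVec, ← Matrix.mulVec_transpose, hs,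
            Matrix.mulVec_mulVec, hi, dotProduct_comm]
      _ ≤ _ := dotProduct_le_vnorm _ _
  have h1 := vnorm_nonneg x
  have h2 := vnorm_nonneg (S *ᵥ x)
  nlinarith

lemma symm_idem_one_sub [DecidableEq ι] {S : Matrix ι ι ℝ} (hs : Sᵀ = S) (hi : S * S = S) :
    (1 - S)ᵀ = 1 - S ∧ (1 - S) * (1 - S) = 1 - S := by
  refine ⟨by simp [hs], ?_⟩
  rw [Matrix.mul_sub, Matrix.sub_mul, Matrix.sub_mul, hi]
  simp

lemma mul_eq_one_of_isMoorePenrose [DecidableEq κ] {O : Matrix ι κ ℝ} {O' : Matrix κ ι ℝ}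
    {τ : ℝ} (hτ : 0 < τ) (hO : ∀ x, τ * vnorm x ≤ vnorm (O *ᵥ x)) (h : IsMoorePenrose O O') :
    O' * O = 1 := by
  rw [← sub_eq_zero]
  refine Matrix.ext_of_mulVec_single fun j => ?_
  rw [Matrix.zero_mulVec]
  refine vnorm_eq_zero.1 (le_antisymm ?_ (vnorm_nonneg _))
  have h1 := hO ((O' * O - 1) *ᵥ Pi.single j 1)
  rw [Matrix.mulVec_mulVec, Matrix.mul_sub, ← Matrix.mul_assoc, h.1, Matrix.mul_one, sub_self,
    Matrix.zero_mulVec, vnorm_zero] at h1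
  exact nonpos_of_mul_nonpos_right h1 hτ

lemma norm_le_of_isMoorePenrose [DecidableEq ι] {O : Matrix ι κ ℝ} {O' : Matrix κ ι ℝ}
    {τ : ℝ} (hτ : 0 < τ) (hO : ∀ x, τ * vnorm x ≤ vnorm (O *ᵥ x)) (h : IsMoorePenrose O O') :
    ‖O'‖ ≤ 1 / τ := by
  refine norm_le_of_vnorm_mulVec (by positivity) fun y => ?_
  have h1 := hO (O' *ᵥ y)
  have h2 : ‖O * O'‖ ≤ 1 := norm_le_one_of_symm_idem h.2.2.1 (by rw [← Matrix.mul_assoc, h.1])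
  have h3 := vnorm_mulVec_le (O * O') y
  rw [Matrix.mulVec_mulVec] at h1
  rw [div_mul_eq_mul_div, le_div_iff₀ hτ]
  nlinarith [vnorm_nonneg y]

lemma IsMoorePenrose.transpose {O : Matrix ι κ ℝ} {O' : Matrix κ ι ℝ} (h : IsMoorePenrose O O') :
    IsMoorePenrose Oᵀ O'ᵀ := by
  obtain ⟨h1, h2, h3, h4⟩ := h
  refine ⟨?_, ?_, ?_, ?_⟩
  · rw [← Matrix.transpose_mul, ← Matrix.transpose_mul, ← Matrix.mul_assoc, h1]
  · rw [← Matrix.transpose_mul, ← Matrix.transpose_mul, ← Matrix.mul_assoc, h2]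
  · rw [← Matrix.transpose_mul, h4, h4]
  · rw [← Matrix.transpose_mul, h3, h3]

/-- Perturbation of the pseudo-inverse of a matrix `O` with full column rank. With `X = O - E`,
`O† - X† = -O† E X† + O† O†ᵀ Eᵀ (1 - X X†)`. -/
lemma norm_pinv_sub_pinv_le [DecidableEq ι] [DecidableEq κ] {O X : Matrix ι κ ℝ}
    {O' X' : Matrix κ ι ℝ} {τ e : ℝ} (hτ : 0 < τ)
    (hO : ∀ x, τ * vnorm x ≤ vnorm (O *ᵥ x)) (hO' : IsMoorePenrose O O')
    (hX : ∀ x, τ / 2 * vnorm x ≤ vnorm (X *ᵥ x)) (hX' : IsMoorePenrose X X')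
    (hE : ‖O - X‖ ≤ e) : ‖X' - O'‖ ≤ 3 * e / τ ^ 2 := by
  have hOO := mul_eq_one_of_isMoorePenrose hτ hO hO'
  have nO := norm_le_of_isMoorePenrose hτ hO hO'
  have nX := norm_le_of_isMoorePenrose (by positivity) hX hX'
  set E := O - X with hEdef
  have he : 0 ≤ e := (norm_nonneg _).trans hE
  have key : X' - O' = O' * E * X' - O' * O'ᵀ * Eᵀ * (1 - X * X') := by
    have e1 : O' * O'ᵀ * Oᵀ = O' := by
      rw [Matrix.mul_assoc, ← Matrix.transpose_mul, hO'.2.2.1, ← Matrix.mul_assoc, hO'.2.1]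
    have e2 : Xᵀ * (X * X') = Xᵀ := by
      rw [← hX'.2.2.1, ← Matrix.transpose_mul, hX'.1]
    have e3 : O' * X * X' = O' * O * X' - O' * E * X' := by
      rw [hEdef, Matrix.mul_sub, Matrix.sub_mul]; abel
    have e4 : O' * O'ᵀ * Eᵀ * (1 - X * X') = O' - O' * X * X' := by
      have : Eᵀ * (1 - X * X') = Oᵀ * (1 - X * X') := by
        rw [hEdef, Matrix.transpose_sub, Matrix.sub_mul, Matrix.mul_sub Xᵀ, e2]; simp
      rw [Matrix.mul_assoc (O' * O'ᵀ), this, ← Matrix.mul_assoc, e1, Matrix.mul_sub,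
        Matrix.mul_one, Matrix.mul_assoc O' X X']
    rw [e4, e3, hOO, Matrix.one_mul]; abel
  have hP : ‖(1 - X * X' : Matrix ι ι ℝ)‖ ≤ 1 := by
    obtain ⟨h1, h2⟩ := symm_idem_one_sub hX'.2.2.1 (by rw [← Matrix.mul_assoc, hX'.1])
    exact norm_le_one_of_symm_idem h1 h2
  have b1 : ‖O' * E * X'‖ ≤ 1 / τ * e * (1 / (τ / 2)) :=
    (Matrix.l2_opNorm_mul _ _).trans
      (mul_le_mul ((Matrix.l2_opNorm_mul _ _).trans (by gcongr)) nX (norm_nonneg _)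
        (by positivity))
  have b2 : ‖O' * O'ᵀ * Eᵀ * (1 - X * X')‖ ≤ 1 / τ * (1 / τ) * e * 1 := by
    refine (Matrix.l2_opNorm_mul _ _).trans
      (mul_le_mul ((Matrix.l2_opNorm_mul _ _).trans (mul_le_mul ((Matrix.l2_opNorm_mul _ _).trans
        ?_) ?_ (norm_nonneg _) (by positivity))) hP (norm_nonneg _) (by positivity))
    · rw [norm_transpose]; gcongr
    · rw [norm_transpose]; exact hE
  rw [key]
  refine (norm_sub_le _ _).trans ((add_le_add b1 b2).trans_eq ?_)
  field_simp
  ring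

end Pinv

/-! ### Stability of the state matrix -/

section Stability

variable {ι κ ν : Type*} [Fintype ι] [Fintype κ] [Fintype ν] [DecidableEq ι] [DecidableEq κ]
  [DecidableEq ν]

/-- Two rank factorizations `L = O Q` and `Lhat = Ohat Qhat` give state matrices that are close up
to a similarity. The similarity `T = Qhat Q†` is the one that makes `Ohat T = Lhat Q†` close to
`L Q† = O`; moreover `Qhat† T` is the projection of `Q†` to the row space of `Lhat`. -/
theorem exists_similar_state_near {O Oh : Matrix ι ν ℝ} {Q Qh : Matrix ν κ ℝ}
    {O' Oh' : Matrix ν ι ℝ} {Q' Qh' : Matrix κ ν ℝ} {L Lh H Hh : Matrix ι κ ℝ} {τ e η : ℝ}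
    (hτ : 0 < τ)
    (hO : ∀ x, τ * vnorm x ≤ vnorm (O *ᵥ x)) (hQ : ∀ x, τ * vnorm x ≤ vnorm (Qᵀ *ᵥ x))
    (hO' : IsMoorePenrose O O') (hQ' : IsMoorePenrose Q Q')
    (hOh' : IsMoorePenrose Oh Oh') (hQh' : IsMoorePenrose Qh Qh')
    (hL : L = O * Q) (hLh : Lh = Oh * Qh) (he : ‖L - Lh‖ ≤ e) (heτ : e ≤ τ ^ 2 / 2)
    (hη : ‖Hh - H‖ ≤ η) :
    ∃ T S : Matrix ν ν ℝ, T * S = 1 ∧ S * T = 1 ∧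
      ‖S * (Oh' * Hh * Qh') * T - O' * H * Q'‖ ≤ 2 * η / τ ^ 2 + 4 * e * ‖H‖ / τ ^ 4 := by
  have he0 : 0 ≤ e := (norm_nonneg _).trans he
  have hη0 : 0 ≤ η := (norm_nonneg _).trans hη
  have hOO := mul_eq_one_of_isMoorePenrose hτ hO hO'
  have nO := norm_le_of_isMoorePenrose hτ hO hO'
  have hQQ : Q * Q' = 1 := by
    have := mul_eq_one_of_isMoorePenrose hτ hQ hQ'.transpose
    rw [← Matrix.transpose_mul, ← Matrix.transpose_one] at this
    exact Matrix.transpose_injective this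
  have nQ : ‖Q'‖ ≤ 1 / τ := by
    rw [← norm_transpose]; exact norm_le_of_isMoorePenrose hτ hQ hQ'.transpose
  set T := Qh * Q' with hT
  have hX0 : O - Oh * T = (L - Lh) * Q' := by
    rw [Matrix.sub_mul, hL, hLh, Matrix.mul_assoc, hQQ, Matrix.mul_one, hT, Matrix.mul_assoc]
  have hE : ‖O - Oh * T‖ ≤ e / τ := by
    rw [hX0]
    refine (Matrix.l2_opNorm_mul _ _).trans ?_
    calc _ ≤ e * (1 / τ) := by gcongr
      _ = _ := by ring
  have hX : ∀ x, τ / 2 * vnorm x ≤ vnorm ((Oh * T) *ᵥ x) := fun x => by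
    have h1 := hO x
    have h2 : O *ᵥ x = (O - Oh * T) *ᵥ x + (Oh * T) *ᵥ x := by
      rw [← Matrix.add_mulVec, sub_add_cancel]
    have h3 := vnorm_add_le ((O - Oh * T) *ᵥ x) ((Oh * T) *ᵥ x)
    rw [← h2] at h3
    have h4 := vnorm_mulVec_le (O - Oh * T) x
    have h5 : e / τ ≤ τ / 2 := by rw [div_le_iff₀ hτ]; nlinarith
    nlinarith [vnorm_nonneg x]
  have hTinj : Function.Injective T.mulVec := by
    intro x y hxy
    have h0 : T *ᵥ (x - y) = 0 := by rw [Matrix.mulVec_sub, hxy, sub_self]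
    have h1 := hX (x - y)
    rw [← Matrix.mulVec_mulVec, h0, Matrix.mulVec_zero, vnorm_zero] at h1
    have h2 : vnorm (x - y) ≤ 0 := nonpos_of_mul_nonpos_right h1 (by positivity)
    exact sub_eq_zero.1 (vnorm_eq_zero.1 (le_antisymm h2 (vnorm_nonneg _)))
  have hTu : IsUnit T.det := (Matrix.isUnit_iff_isUnit_det _).1
    (Matrix.mulVec_injective_iff_isUnit.1 hTinj)
  have hTS : T * T⁻¹ = 1 := Matrix.mul_nonsing_inv _ hTu
  have hST : T⁻¹ * T = 1 := Matrix.nonsing_inv_mul _ hTu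
  have hOhOh : Oh' * Oh = 1 := by
    have h1 : (Oh' * Oh - 1) = 0 := by
      refine Matrix.ext_of_mulVec_single fun j => ?_
      rw [Matrix.zero_mulVec]
      set z := (Oh' * Oh - 1) *ᵥ Pi.single j 1 with hz
      have h2 : Oh *ᵥ z = 0 := by
        rw [hz, Matrix.mulVec_mulVec, Matrix.mul_sub, ← Matrix.mul_assoc, hOh'.1, Matrix.mul_one,
          sub_self, Matrix.zero_mulVec]
      clear_value z
      have h3 := hX (T⁻¹ *ᵥ z)
      rw [Matrix.mulVec_mulVec, Matrix.mul_assoc, hTS, Matrix.mul_one, h2, vnorm_zero] at h3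
      have h4 : vnorm (T⁻¹ *ᵥ z) ≤ 0 := nonpos_of_mul_nonpos_right h3 (by positivity)
      have h5 := vnorm_eq_zero.1 (le_antisymm h4 (vnorm_nonneg _))
      calc z = T *ᵥ (T⁻¹ *ᵥ z) := by rw [Matrix.mulVec_mulVec, hTS, Matrix.one_mulVec]
        _ = 0 := by rw [h5, Matrix.mulVec_zero]
    exact sub_eq_zero.1 h1
  -- `T⁻¹ Ohat†` is the pseudo-inverse of `Ohat T`.
  have hX' : IsMoorePenrose (Oh * T) (T⁻¹ * Oh') := by
    have e1 : (Oh * T) * (T⁻¹ * Oh') = Oh * Oh' := by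
      rw [Matrix.mul_assoc, ← Matrix.mul_assoc T, hTS, Matrix.one_mul]
    have e2 : (T⁻¹ * Oh') * (Oh * T) = 1 := by
      rw [Matrix.mul_assoc, ← Matrix.mul_assoc Oh', hOhOh, Matrix.one_mul, hST]
    refine ⟨?_, ?_, ?_, ?_⟩
    · rw [Matrix.mul_assoc, e2, Matrix.mul_one]
    · rw [e2, Matrix.one_mul]
    · rw [e1, hOh'.2.2.1]
    · rw [e2, Matrix.transpose_one]
  have nX := norm_le_of_isMoorePenrose (by positivity) hX hX'
  have nXO := norm_pinv_sub_pinv_le hτ hO hO' hX hX' hE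
  set X' := T⁻¹ * Oh' with hXdef
  set R := Qh' * T with hR
  have hPs : (Qh' * Qh)ᵀ = Qh' * Qh := hQh'.2.2.2
  have hPi : (Qh' * Qh) * (Qh' * Qh) = Qh' * Qh := by rw [← Matrix.mul_assoc, hQh'.2.1]
  have hRP : R = Qh' * Qh * Q' := by rw [hR, hT, Matrix.mul_assoc]
  have nR : ‖R‖ ≤ 1 / τ := by
    rw [hRP]
    refine (Matrix.l2_opNorm_mul _ _).trans ?_
    calc _ ≤ 1 * (1 / τ) := by
          gcongr
          exact norm_le_one_of_symm_idem hPs hPi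
      _ = _ := one_mul _
  have nRQ : ‖R - Q'‖ ≤ e / τ ^ 3 := by
    have e1 : Q' = Lᵀ * (O'ᵀ * Q'ᵀ * Q') := by
      have : Lᵀ * (O'ᵀ * Q'ᵀ) = Q' * Q := by
        rw [hL, Matrix.transpose_mul, Matrix.mul_assoc, ← Matrix.mul_assoc Oᵀ,
          ← Matrix.transpose_mul O' O, hOO, Matrix.transpose_one, Matrix.one_mul,
          ← Matrix.transpose_mul, hQ'.2.2.2]
      rw [← Matrix.mul_assoc Lᵀ, this, hQ'.2.1]
    have e2 : (1 - Qh' * Qh) * Lhᵀ = 0 := by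
      have : Lh * (Qh' * Qh) = Lh := by
        rw [hLh, Matrix.mul_assoc, ← Matrix.mul_assoc Qh, hQh'.1]
      rw [← hPs, Matrix.sub_mul, ← Matrix.transpose_mul, this, Matrix.one_mul, sub_self]
    have e3 : R - Q' = -((1 - Qh' * Qh) * (L - Lh)ᵀ * (O'ᵀ * Q'ᵀ * Q')) := by
      rw [Matrix.transpose_sub, Matrix.mul_sub, e2, sub_zero, Matrix.mul_assoc, ← e1, hRP,
        Matrix.sub_mul, Matrix.one_mul]
      abel
    obtain ⟨h1, h2⟩ := symm_idem_one_sub hPs hPi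
    rw [e3, norm_neg]
    calc _ ≤ 1 * e * (1 / τ * (1 / τ) * (1 / τ)) := by
          refine (Matrix.l2_opNorm_mul _ _).trans (mul_le_mul ((Matrix.l2_opNorm_mul _ _).trans
            (mul_le_mul (norm_le_one_of_symm_idem h1 h2) ?_ (norm_nonneg _) zero_le_one))
            ((Matrix.l2_opNorm_mul _ _).trans (mul_le_mul ((Matrix.l2_opNorm_mul _ _).trans ?_) nQ
              (norm_nonneg _) (by positivity))) (norm_nonneg _) (by positivity))
          · rw [norm_transpose]; exact he
          · rw [norm_transpose, norm_transpose]; gcongr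
      _ = _ := by field_simp
  refine ⟨T, T⁻¹, hTS, hST, ?_⟩
  have key : T⁻¹ * (Oh' * Hh * Qh') * T - O' * H * Q'
      = X' * (Hh - H) * R + (X' - O') * H * R + O' * H * (R - Q') := by
    have : T⁻¹ * (Oh' * Hh * Qh') * T = X' * Hh * R := by
      simp only [hXdef, hR, Matrix.mul_assoc]
    rw [this]
    simp only [Matrix.mul_sub, Matrix.sub_mul]
    abel
  rw [key]
  have b1 : ‖X' * (Hh - H) * R‖ ≤ 1 / (τ / 2) * η * (1 / τ) :=
    (Matrix.l2_opNorm_mul _ _).trans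
      (mul_le_mul ((Matrix.l2_opNorm_mul _ _).trans (by gcongr)) nR (norm_nonneg _)
        (by positivity))
  have b2 : ‖(X' - O') * H * R‖ ≤ 3 * (e / τ) / τ ^ 2 * ‖H‖ * (1 / τ) :=
    (Matrix.l2_opNorm_mul _ _).trans
      (mul_le_mul ((Matrix.l2_opNorm_mul _ _).trans (by gcongr)) nR (norm_nonneg _)
        (by positivity))
  have b3 : ‖O' * H * (R - Q')‖ ≤ 1 / τ * ‖H‖ * (e / τ ^ 3) :=
    (Matrix.l2_opNorm_mul _ _).trans
      (mul_le_mul ((Matrix.l2_opNorm_mul _ _).trans (by gcongr)) nRQ (norm_nonneg _)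
        (by positivity))
  refine (norm_add_le _ _).trans ((add_le_add ((norm_add_le _ _).trans (add_le_add b1 b2))
    b3).trans_eq ?_)
  field_simp
  ring

end Stability

/-! ### Singular values -/

section SingularValues

open Module LinearMap

variable {𝕜 E F : Type*} [RCLike 𝕜] [NormedAddCommGroup E] [InnerProductSpace 𝕜 E]
  [FiniteDimensional 𝕜 E] [NormedAddCommGroup F] [InnerProductSpace 𝕜 F] [FiniteDimensional 𝕜 F]

lemma norm_sq_eq_sum_singularValues (T : E →ₗ[𝕜] F) (x : E) :
    ‖T x‖ ^ 2 = ∑ i : Fin (finrank 𝕜 E), T.singularValues i ^ 2 *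
      ‖(T.isSymmetric_adjoint_comp_self.eigenvectorBasis rfl).repr x i‖ ^ 2 := by
  set b := T.isSymmetric_adjoint_comp_self.eigenvectorBasis rfl with hb
  have h1 : ((‖T x‖ ^ 2 : ℝ) : 𝕜) = inner 𝕜 (b.repr x) (b.repr ((adjoint T ∘ₗ T) x)) := by
    rw [b.repr.inner_map_map, coe_comp, Function.comp_apply, adjoint_inner_right,
      inner_self_eq_norm_sq_to_K]
    push_cast
    rfl
  have h2 : ((‖T x‖ ^ 2 : ℝ) : 𝕜) = ((∑ i : Fin (finrank 𝕜 E), T.singularValues i ^ 2 *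
      ‖b.repr x i‖ ^ 2 : ℝ) : 𝕜) := by
    rw [h1, PiLp.inner_apply, RCLike.ofReal_sum]
    refine Finset.sum_congr rfl fun i _ => ?_
    rw [hb, IsSymmetric.eigenvectorBasis_apply_self_apply, ← hb, ← T.sq_singularValues_fin rfl i,
      RCLike.inner_apply, mul_assoc, RCLike.mul_conj]
    push_cast
    rfl
  exact_mod_cast h2

lemma norm_sq_eq_sum_repr (T : E →ₗ[𝕜] F) (x : E) :
    ‖x‖ ^ 2 = ∑ i : Fin (finrank 𝕜 E),
      ‖(T.isSymmetric_adjoint_comp_self.eigenvectorBasis rfl).repr x i‖ ^ 2 := by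
  rw [← EuclideanSpace.norm_sq_eq, LinearIsometryEquiv.norm_map]

/-- The modulus of the determinant is at most the length of the image of any unit vector, times
the operator norm to the power `dim - 1`: the former dominates the smallest singular value, the
latter all the others. -/
lemma norm_det_mul_le (T : E →ₗ[𝕜] E) (x : E) {r : ℝ} (hr : ∀ z, ‖T z‖ ≤ r * ‖z‖)
    (hd : 0 < finrank 𝕜 E) : ‖T.det‖ * ‖x‖ ≤ ‖T x‖ * r ^ (finrank 𝕜 E - 1) := by
  set b := T.isSymmetric_adjoint_comp_self.eigenvectorBasis rfl with hb
  obtain ⟨d, hd'⟩ : ∃ d, finrank 𝕜 E = d + 1 := ⟨_, (Nat.sub_add_cancel hd).symm⟩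
  have hs : ∀ i : Fin (finrank 𝕜 E), T.singularValues i ≤ r := fun i => by
    have h1 := norm_sq_eq_sum_singularValues T (b i)
    rw [← hb] at h1
    simp only [OrthonormalBasis.repr_self, PiLp.single_apply] at h1
    rw [Finset.sum_eq_single i (fun j _ hj => by simp [hj]) (by simp)] at h1
    have h2 := hr (b i)
    simp only [b.norm_eq_one, mul_one] at h2
    simp only [if_true, norm_one, one_pow, mul_one] at h1
    exact ((sq_eq_sq₀ (norm_nonneg _) (T.singularValues_nonneg _)).1 h1).symm.trans_le h2
  have hlast : T.singularValues d * ‖x‖ ≤ ‖T x‖ := by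
    refine le_of_sq_le_sq ?_ (norm_nonneg _)
    rw [mul_pow, norm_sq_eq_sum_singularValues T x, norm_sq_eq_sum_repr T x, Finset.mul_sum]
    gcongr with i
    · exact T.singularValues_nonneg _
    · exact T.singularValues_antitone (by omega)
  have hr0 : 0 ≤ r := (T.singularValues_nonneg _).trans (hs ⟨0, hd⟩)
  rw [← normDet_eq_norm_det, normDet_eq_prod_singularValues, hd', Finset.prod_range_succ,
    Nat.add_sub_cancel, mul_assoc, mul_comm]
  refine mul_le_mul hlast ?_ (Finset.prod_nonneg fun i _ => T.singularValues_nonneg _)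
    (norm_nonneg _)
  calc _ ≤ ∏ _i ∈ Finset.range d, r :=
        Finset.prod_le_prod (fun i _ => T.singularValues_nonneg _) fun i hi =>
          hs ⟨i, by rw [hd']; exact (Finset.mem_range.1 hi).trans (Nat.lt_succ_self d)⟩
    _ = r ^ d := by simp

end SingularValues

/-! ### Variation of the spectrum -/

section Elsner

variable {ν : Type*} [Fintype ν] [DecidableEq ν]

/-- Matrix form of `norm_det_mul_le`. -/
lemma norm_matrix_det_mul_le [Nonempty ν] (M : Matrix ν ν ℂ) (x : ν → ℂ) :
    ‖M.det‖ * vnorm x ≤ vnorm (M *ᵥ x) * ‖M‖ ^ (Fintype.card ν - 1) := by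
  have h := norm_det_mul_le (Matrix.toEuclideanLin M) (WithLp.toLp 2 x) (r := ‖M‖)
    (fun z => vnorm_mulVec_le M z.ofLp) (by simpa using Fintype.card_pos)
  have h2 : (Matrix.toEuclideanLin M).det = M.det := by
    rw [Matrix.toEuclideanLin_eq_toLin_orthonormal, LinearMap.det_toLin]
  rw [h2, finrank_euclideanSpace] at h
  exact h

lemma pow_card_le_norm_prod_sub {m : ℝ} (hm : 0 ≤ m) (μ : ℂ) (s : Multiset ℂ)
    (h : ∀ z ∈ s, m ≤ ‖μ - z‖) : m ^ s.card ≤ ‖(s.map fun z => μ - z).prod‖ := by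
  induction s using Multiset.induction_on with
  | empty => simp
  | cons a s ih =>
    simp only [Multiset.card_cons, Multiset.map_cons, Multiset.prod_cons, norm_mul, pow_succ']
    gcongr
    · exact h a (Multiset.mem_cons_self a s)
    · exact ih fun z hz => h z (Multiset.mem_cons_of_mem hz)

/-- **Elsner's bound** on the one-sided spectral variation. If `x` is a unit eigenvector of `B` for
`μ`, then `∏ |μ - λ_i(A)| = |det (μ - A)|` is at most `‖(μ - A) x‖ = ‖(B - A) x‖` times
`‖μ - A‖ ^ (n - 1)`. -/
theorem exists_spectrum_near [Nonempty ν] (A B : Matrix ν ν ℂ) {μ : ℂ} (hμ : μ ∈ spectrum ℂ B) :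
    ∃ z ∈ spectrum ℂ A, ‖μ - z‖ ≤ (‖A‖ + ‖B‖) ^ (1 - 1 / (Fintype.card ν : ℝ)) *
      ‖A - B‖ ^ (1 / (Fintype.card ν : ℝ)) := by
  set d := Fintype.card ν with hd
  have hd0 : 0 < d := Fintype.card_pos
  obtain ⟨x, hx0, hx⟩ : ∃ x ≠ 0, (algebraMap ℂ _ μ - B) *ᵥ x = 0 := by
    rw [Matrix.exists_mulVec_eq_zero_iff]
    rw [spectrum.mem_iff, Matrix.isUnit_iff_isUnit_det, isUnit_iff_ne_zero, not_not] at hμ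
    exact hμ
  have hxB : B *ᵥ x = μ • x := by
    rw [Matrix.sub_mulVec, sub_eq_zero, Algebra.algebraMap_eq_smul_one, Matrix.smul_mulVec,
      Matrix.one_mulVec] at hx
    exact hx.symm
  have hxpos : 0 < vnorm x :=
    lt_of_le_of_ne (vnorm_nonneg x) fun h => hx0 (vnorm_eq_zero.1 h.symm)
  have hμB : ‖μ‖ ≤ ‖B‖ := by
    have h := vnorm_mulVec_le B x
    rw [hxB, vnorm_smul] at h
    exact le_of_mul_le_mul_right h hxpos
  have hone : ‖(1 : Matrix ν ν ℂ)‖ ≤ 1 := norm_le_of_vnorm_mulVec zero_le_one fun z => by simp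
  have hMn : ‖algebraMap ℂ (Matrix ν ν ℂ) μ - A‖ ≤ ‖A‖ + ‖B‖ := by
    refine (norm_sub_le _ _).trans ?_
    rw [Algebra.algebraMap_eq_smul_one, norm_smul, add_comm]
    gcongr
    calc ‖μ‖ * ‖(1 : Matrix ν ν ℂ)‖ ≤ ‖B‖ * 1 := by gcongr
      _ = _ := mul_one _
  have hMx : (algebraMap ℂ (Matrix ν ν ℂ) μ - A) *ᵥ x = -((A - B) *ᵥ x) := by
    rw [Matrix.sub_mulVec, Matrix.sub_mulVec, hxB, Algebra.algebraMap_eq_smul_one,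
      Matrix.smul_mulVec, Matrix.one_mulVec]
    abel
  have hdet : ‖(algebraMap ℂ (Matrix ν ν ℂ) μ - A).det‖ ≤ (‖A‖ + ‖B‖) ^ (d - 1) * ‖A - B‖ := by
    have h1 := norm_matrix_det_mul_le (algebraMap ℂ (Matrix ν ν ℂ) μ - A) x
    have h2 : vnorm ((algebraMap ℂ (Matrix ν ν ℂ) μ - A) *ᵥ x) ≤ ‖A - B‖ * vnorm x := by
      rw [hMx]
      have : vnorm (-((A - B) *ᵥ x)) = vnorm ((A - B) *ᵥ x) := by simp [vnorm]
      rw [this]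
      exact vnorm_mulVec_le _ _
    refine le_of_mul_le_mul_right (h1.trans ?_) hxpos
    calc _ ≤ (‖A - B‖ * vnorm x) * (‖A‖ + ‖B‖) ^ (d - 1) := by gcongr
      _ = _ := by ring
  have hroots : (algebraMap ℂ (Matrix ν ν ℂ) μ - A).det
      = (A.charpoly.roots.map fun z => μ - z).prod := by
    have h1 : (algebraMap ℂ (Matrix ν ν ℂ) μ - A).det = A.charpoly.eval μ := by
      rw [Matrix.eval_charpoly]; rfl
    have hs := IsAlgClosed.splits A.charpoly
    rw [h1, hs.eval_eq_prod_roots_of_monic (Matrix.charpoly_monic A)]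
  have hcard : A.charpoly.roots.card = d := by
    rw [← (IsAlgClosed.splits A.charpoly).natDegree_eq_card_roots, Matrix.charpoly_natDegree_eq_dim]
  have hne : A.charpoly.roots.toFinset.Nonempty := by
    rw [Multiset.toFinset_nonempty]
    intro h0
    rw [h0, Multiset.card_zero] at hcard
    omega
  obtain ⟨z, hz, hmin⟩ := Finset.exists_min_image _ (fun z => ‖μ - z‖) hne
  refine ⟨z, ?_, ?_⟩
  · rw [Matrix.mem_spectrum_iff_isRoot_charpoly]
    exact Polynomial.isRoot_of_mem_roots (Multiset.mem_toFinset.1 hz)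
  · have hp := pow_card_le_norm_prod_sub (norm_nonneg (μ - z)) μ A.charpoly.roots
      fun y hy => hmin y (Multiset.mem_toFinset.2 hy)
    rw [hcard, ← hroots] at hp
    have hdR : (0 : ℝ) < d := Nat.cast_pos.2 hd0
    calc ‖μ - z‖ = (‖μ - z‖ ^ d) ^ (1 / (d : ℝ)) := by
          rw [one_div, Real.pow_rpow_inv_natCast (norm_nonneg _) hd0.ne']
      _ ≤ ((‖A‖ + ‖B‖) ^ (d - 1) * ‖A - B‖) ^ (1 / (d : ℝ)) := by
          gcongr
          exact hp.trans hdet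
      _ = _ := by
          rw [Real.mul_rpow (by positivity) (norm_nonneg _), ← Real.rpow_natCast,
            ← Real.rpow_mul (by positivity), Nat.cast_sub hd0]
          congr 2
          field_simp
          simp

/-- Complexification does not increase the spectral norm. -/
lemma norm_map_algebraMap_le (M : Matrix ν ν ℝ) : ‖M.map (algebraMap ℝ ℂ)‖ ≤ ‖M‖ := by
  refine norm_le_of_vnorm_mulVec (norm_nonneg _) fun x => ?_
  have hre : ∀ i, ((M.map (algebraMap ℝ ℂ) *ᵥ x) i).re = (M *ᵥ fun j => (x j).re) i := fun i => by
    simp [Matrix.mulVec, dotProduct]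
  have him : ∀ i, ((M.map (algebraMap ℝ ℂ) *ᵥ x) i).im = (M *ᵥ fun j => (x j).im) i := fun i => by
    simp [Matrix.mulVec, dotProduct]
  have hsq : ∀ y : ν → ℂ,
      vnorm y ^ 2 = vnorm (fun j => (y j).re) ^ 2 + vnorm (fun j => (y j).im) ^ 2 := fun y => by
    simp only [vnorm_sq_eq_sum, ← Finset.sum_add_distrib]
    refine Finset.sum_congr rfl fun i _ => ?_
    rw [← Complex.normSq_eq_norm_sq, Complex.normSq_apply, Real.norm_eq_abs, Real.norm_eq_abs,
      sq_abs, sq_abs]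
    ring
  refine le_of_sq_le_sq ?_ (mul_nonneg (norm_nonneg _) (vnorm_nonneg _))
  rw [mul_pow, hsq, hsq x, mul_add]
  simp only [hre, him]
  have h1 := vnorm_mulVec_le M fun j => (x j).re
  have h2 := vnorm_mulVec_le M fun j => (x j).im
  rw [← mul_pow, ← mul_pow]
  exact add_le_add (pow_le_pow_left₀ (vnorm_nonneg _) h1 2)
    (pow_le_pow_left₀ (vnorm_nonneg _) h2 2)

/-- The Hausdorff distance of the spectra is controlled by the distance of `M'` to any matrix
similar to `M`. -/
theorem spectralDist_le {n : ℕ} (hn : 0 < n) {M M' T S : Matrix (Fin n) (Fin n) ℝ} {Δ : ℝ}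
    (hTS : T * S = 1) (hST : S * T = 1) (h : ‖S * M * T - M'‖ ≤ Δ) :
    spectralDist M M' ≤ (Δ + 2 * ‖M'‖) ^ (1 - 1 / (n : ℝ)) * Δ ^ (1 / (n : ℝ)) := by
  have : Nonempty (Fin n) := ⟨⟨0, hn⟩⟩
  have hΔ : 0 ≤ Δ := (norm_nonneg _).trans h
  have hn1 : (1 : ℝ) ≤ n := by exact_mod_cast hn
  set f := (algebraMap ℝ ℂ).mapMatrix (m := Fin n) with hf
  have hspec : spectrum ℂ (M.map (algebraMap ℝ ℂ)) = spectrum ℂ (f (S * M * T)) := by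
    have hu : f S * f T = 1 := by rw [← map_mul, hST, map_one]
    have hu' : f T * f S = 1 := by rw [← map_mul, hTS, map_one]
    let w : (Matrix (Fin n) (Fin n) ℂ)ˣ := ⟨f S, f T, hu, hu'⟩
    rw [map_mul, map_mul]
    exact (spectrum.units_conjugate (R := ℂ) (a := f M) (u := w)).symm
  have hB : ‖f (S * M * T)‖ ≤ Δ + ‖M'‖ := by
    refine (norm_map_algebraMap_le _).trans ?_
    have : S * M * T = (S * M * T - M') + M' := (sub_add_cancel _ _).symm
    rw [this]
    exact (norm_add_le _ _).trans (by gcongr)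
  have hA : ‖f M'‖ ≤ ‖M'‖ := norm_map_algebraMap_le _
  have hAB : ‖f (S * M * T) - f M'‖ ≤ Δ := by
    rw [← map_sub]
    exact (norm_map_algebraMap_le _).trans h
  have hexp : 0 ≤ 1 - 1 / (n : ℝ) := by
    rw [sub_nonneg, div_le_one (by linarith)]; exact hn1
  have hb : ∀ a b c : ℝ, 0 ≤ a → 0 ≤ b → a ≤ Δ + 2 * ‖M'‖ → b ≤ Δ →
      c ≤ a ^ (1 - 1 / (n : ℝ)) * b ^ (1 / (n : ℝ)) →
      c ≤ (Δ + 2 * ‖M'‖) ^ (1 - 1 / (n : ℝ)) * Δ ^ (1 / (n : ℝ)) := by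
    intro a b c ha hb0 haΔ hbΔ hc
    refine hc.trans ?_
    gcongr
  rw [spectralDist, hspec]
  refine Metric.hausdorffDist_le_of_mem_dist (by positivity) (fun μ hμ => ?_) fun μ hμ => ?_
  · obtain ⟨z, hz, hle⟩ := exists_spectrum_near (f M') _ hμ
    refine ⟨z, hz, ?_⟩
    rw [dist_eq_norm]
    rw [Fintype.card_fin] at hle
    refine hb _ _ _ (by positivity) (norm_nonneg _) ?_ ?_ hle
    · linarith
    · rw [norm_sub_rev]; exact hAB
  · obtain ⟨z, hz, hle⟩ := exists_spectrum_near (f (S * M * T)) (f M') hμ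
    refine ⟨z, hz, ?_⟩
    rw [dist_eq_norm]
    rw [Fintype.card_fin] at hle
    exact hb _ _ _ (by positivity) (norm_nonneg _) (by linarith) hAB hle

end Elsner

/-! ### Balanced factorizations -/

section Balanced

variable {ι κ : Type*} [Fintype ι] [Fintype κ]

lemma vnorm_mulVec_of_transpose_mul_self {n : ℕ} {U : Matrix ι (Fin n) ℝ} (hU : Uᵀ * U = 1)
    (x : Fin n → ℝ) : vnorm (U *ᵥ x) = vnorm x := by
  rw [← sq_eq_sq₀ (vnorm_nonneg _) (vnorm_nonneg _), vnorm_sq, vnorm_sq, Matrix.dotProduct_mulVec,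
    ← Matrix.mulVec_transpose, Matrix.mulVec_mulVec, hU, Matrix.one_mulVec]

lemma norm_le_one_of_transpose_mul_self {n : ℕ} {U : Matrix ι (Fin n) ℝ} (hU : Uᵀ * U = 1) :
    ‖U‖ ≤ 1 :=
  norm_le_of_vnorm_mulVec zero_le_one fun x => by
    rw [vnorm_mulVec_of_transpose_mul_self hU, one_mul]

/-- All entries of the diagonal factor of a singular value decomposition with `n` terms are at
least `σ_n`. Some nonzero `x` is orthogonal both to the first `n - 1` right singular vectors and
to the eigenvectors for `σ_{n+1}, σ_{n+2}, …`; the image of `x` has length at least `σ_n ‖x‖` and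
at most `s_n ‖x‖`. -/
lemma sigma_le_of_svd [DecidableEq ι] [DecidableEq κ] {n : ℕ} {L : Matrix ι κ ℝ}
    {U : Matrix ι (Fin n) ℝ} {s : Fin n → ℝ}
    {V : Matrix κ (Fin n) ℝ} (hU : Uᵀ * U = 1) (hV : Vᵀ * V = 1) (hs : Antitone s)
    (hs0 : ∀ i, 0 ≤ s i) (hL : L = U * Matrix.diagonal s * Vᵀ) (i : Fin n) : sigma n L ≤ s i := by
  obtain ⟨k, rfl⟩ : ∃ k, n = k + 1 := ⟨n - 1, by have := i.isLt; omega⟩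
  set T := Matrix.toEuclideanLin L with hT
  rw [sigma, ← hT, Nat.add_sub_cancel]
  refine le_trans ?_ (hs (Fin.le_last i))
  rcases le_or_gt (Module.finrank ℝ (EuclideanSpace ℝ κ)) k with hk | hk
  · rw [T.singularValues_of_finrank_le hk]
    exact hs0 _
  set d := Module.finrank ℝ (EuclideanSpace ℝ κ) with hd
  set b := T.isSymmetric_adjoint_comp_self.eigenvectorBasis rfl with hb
  let Ψ : EuclideanSpace ℝ κ →ₗ[ℝ] (Fin k → ℝ) × ({j : Fin d // (⟨k, hk⟩ : Fin d) < j} → ℝ) :=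
    (LinearMap.pi fun j => LinearMap.proj (j.castSucc) ∘ₗ Vᵀ.mulVecLin ∘ₗ
      (WithLp.linearEquiv 2 ℝ (κ → ℝ)).toLinearMap).prod
    (LinearMap.pi fun j => LinearMap.proj j.1 ∘ₗ (WithLp.linearEquiv 2 ℝ (Fin d → ℝ)).toLinearMap ∘ₗ
      b.repr.toLinearEquiv.toLinearMap)
  have hker : LinearMap.ker Ψ ≠ ⊥ := by
    refine LinearMap.ker_ne_bot_of_finrank_lt ?_
    rw [Module.finrank_prod, Module.finrank_fintype_fun_eq_card,
      Module.finrank_fintype_fun_eq_card, Fintype.card_fin, Fintype.card_subtype, ← hd]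
    have : (Finset.univ.filter fun j : Fin d => (⟨k, hk⟩ : Fin d) < j) = Finset.Ioi ⟨k, hk⟩ := by
      ext j; simp
    rw [this, Fin.card_Ioi]
    simp only
    omega
  obtain ⟨x, hx, hx0⟩ := Submodule.exists_mem_ne_zero_of_ne_bot hker
  rw [LinearMap.mem_ker, Prod.ext_iff] at hx
  have hx1 : ∀ j : Fin k, (Vᵀ *ᵥ x.ofLp) j.castSucc = 0 := fun j => congrFun hx.1 j
  have hx2 : ∀ j : Fin d, k < (j : ℕ) → b.repr x j = 0 := fun j hj => congrFun hx.2 ⟨j, hj⟩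
  have hxpos : 0 < ‖x‖ := norm_pos_iff.2 hx0
  have lower : T.singularValues k * ‖x‖ ≤ ‖T x‖ := by
    refine le_of_sq_le_sq ?_ (norm_nonneg _)
    rw [mul_pow, norm_sq_eq_sum_singularValues T x, norm_sq_eq_sum_repr T x, Finset.mul_sum]
    refine Finset.sum_le_sum fun j _ => ?_
    rcases lt_or_ge k (j : ℕ) with h | h
    · rw [← hb, hx2 j h]; simp
    · gcongr
      · exact T.singularValues_nonneg _
      · exact T.singularValues_antitone h
  have upper : ‖T x‖ ≤ s (Fin.last k) * ‖x‖ := by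
    have e1 : ‖T x‖ = vnorm (Matrix.diagonal s *ᵥ (Vᵀ *ᵥ x.ofLp)) := by
      have : ‖T x‖ = vnorm (L *ᵥ x.ofLp) := rfl
      rw [this, hL, ← Matrix.mulVec_mulVec, ← Matrix.mulVec_mulVec,
        vnorm_mulVec_of_transpose_mul_self hU]
    have e2 : Matrix.diagonal s *ᵥ (Vᵀ *ᵥ x.ofLp) = s (Fin.last k) • (Vᵀ *ᵥ x.ofLp) := by
      ext j
      rw [Matrix.mulVec_diagonal, Pi.smul_apply, smul_eq_mul]
      refine Fin.lastCases rfl (fun j => ?_) j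
      rw [hx1 j, mul_zero, mul_zero]
    have e3 : vnorm (Vᵀ *ᵥ x.ofLp) ≤ ‖x‖ := by
      refine (vnorm_mulVec_le _ _).trans ?_
      rw [norm_transpose]
      exact (mul_le_mul_of_nonneg_right (norm_le_one_of_transpose_mul_self hV)
        (vnorm_nonneg _)).trans_eq (one_mul _)
    rw [e1, e2, vnorm_smul, Real.norm_of_nonneg (hs0 _)]
    exact mul_le_mul_of_nonneg_left e3 (hs0 _)
  exact le_of_mul_le_mul_right (lower.trans upper) hxpos

lemma vnorm_diagonal_mulVec_ge {n : ℕ} {s : Fin n → ℝ} {τ : ℝ} (hτ : 0 ≤ τ) (h : ∀ i, τ ≤ s i)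
    (x : Fin n → ℝ) : τ * vnorm x ≤ vnorm (Matrix.diagonal s *ᵥ x) := by
  refine le_of_sq_le_sq ?_ (vnorm_nonneg _)
  rw [mul_pow, vnorm_sq_eq_sum, vnorm_sq_eq_sum, Finset.mul_sum]
  refine Finset.sum_le_sum fun i _ => ?_
  rw [Matrix.mulVec_diagonal, norm_mul, mul_pow]
  gcongr
  exact (h i).trans (le_abs_self _)

lemma IsBalancedFactorization.eq_mul {n : ℕ} {L : Matrix ι κ ℝ} {O : Matrix ι (Fin n) ℝ}
    {Q : Matrix (Fin n) κ ℝ} (h : IsBalancedFactorization n L O Q) : L = O * Q := by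
  obtain ⟨U, s, V, -, -, -, hs0, hL, hO, hQ⟩ := h
  rw [hL, hO, hQ, Matrix.mul_assoc U (Matrix.diagonal fun i => √(s i)),
    ← Matrix.mul_assoc (Matrix.diagonal fun i => √(s i)), Matrix.diagonal_mul_diagonal,
    Matrix.mul_assoc]
  simp only [Real.mul_self_sqrt (hs0 _)]

lemma IsBalancedFactorization.lower_bounds [DecidableEq ι] [DecidableEq κ] {n : ℕ}
    {L : Matrix ι κ ℝ} {O : Matrix ι (Fin n) ℝ}
    {Q : Matrix (Fin n) κ ℝ} (h : IsBalancedFactorization n L O Q) (x : Fin n → ℝ) :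
    √(sigma n L) * vnorm x ≤ vnorm (O *ᵥ x) ∧ √(sigma n L) * vnorm x ≤ vnorm (Qᵀ *ᵥ x) := by
  obtain ⟨U, s, V, hU, hV, hanti, hs0, hL, hO, hQ⟩ := h
  have hd := vnorm_diagonal_mulVec_ge (Real.sqrt_nonneg (sigma n L))
    (fun i => Real.sqrt_le_sqrt (sigma_le_of_svd hU hV hanti hs0 hL i)) x
  constructor
  · rw [hO, ← Matrix.mulVec_mulVec, vnorm_mulVec_of_transpose_mul_self hU]
    exact hd
  · rw [hQ, Matrix.transpose_mul, Matrix.transpose_transpose, Matrix.diagonal_transpose,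
      ← Matrix.mulVec_mulVec, vnorm_mulVec_of_transpose_mul_self hV]
    exact hd

end Balanced

/-! ### The Hankel matrix -/

section Hankel

lemma mulVec_injective_of_rank {ι : Type*} [Fintype ι] {n : ℕ} {M : Matrix ι (Fin n) ℝ}
    (h : M.rank = n) : Function.Injective M.mulVec := by
  have h1 := LinearMap.finrank_range_add_finrank_ker M.mulVecLin
  rw [Module.finrank_fintype_fun_eq_card, Fintype.card_fin] at h1
  rw [Matrix.rank] at h
  have h2 : Module.finrank ℝ (LinearMap.ker M.mulVecLin) = 0 := by omega
  exact LinearMap.ker_eq_bot.1 (Submodule.finrank_eq_zero.1 h2)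

lemma rank_of_mulVec_injective {ι : Type*} [Fintype ι] {n : ℕ} {M : Matrix ι (Fin n) ℝ}
    (h : Function.Injective M.mulVec) : M.rank = n := by
  have h1 : LinearMap.ker M.mulVecLin = ⊥ := LinearMap.ker_eq_bot.2 h
  rw [Matrix.rank, LinearMap.finrank_range_of_inj (LinearMap.ker_eq_bot.1 h1)]
  simp

/-- A matrix that contains the rows of a matrix of full column rank has full column rank. -/
lemma rank_of_submatrix_rank {ι ι' : Type*} [Fintype ι] [Fintype ι'] {n : ℕ}
    {M : Matrix ι (Fin n) ℝ} (f : ι' → ι) (h : (M.submatrix f id).rank = n) : M.rank = n := by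
  refine rank_of_mulVec_injective fun x y hxy => mulVec_injective_of_rank h ?_
  ext i
  exact congrFun hxy (f i)

variable {n m p K₁ K₂ : ℕ}

/-- Without noise, the Hankel matrix has rank `n`, being the product of the observability and the
controllability matrix. -/
lemma rank_hankelMinus (hK₁ : n ≤ K₁) (hK₂ : n ≤ K₂)
    {A : Matrix (Fin n) (Fin n) ℝ} {B : Matrix (Fin n) (Fin p) ℝ}
    {C : Matrix (Fin m) (Fin n) ℝ} (D : Matrix (Fin m) (Fin p) ℝ)
    (hobs : IsObservable A C) (hctr : IsControllable A B) :
    (hankelMinus (markov (K₁ + K₂ + 1) A B C D)).rank = n := by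
  set Ob : Matrix (Fin K₁ × Fin m) (Fin n) ℝ := Matrix.of fun ia b => (C * A ^ (ia.1 : ℕ)) ia.2 b
    with hOb
  set Ct : Matrix (Fin n) (Fin K₂ × Fin p) ℝ := Matrix.of fun a jb => (A ^ (jb.1 : ℕ) * B) a jb.2
    with hCt
  have hH : hankelMinus (markov (K₁ + K₂ + 1) A B C D) = Ob * Ct := by
    ext ia jb
    have : (Ob * Ct) ia jb = ((C * A ^ (ia.1 : ℕ)) * (A ^ (jb.1 : ℕ) * B)) ia.2 jb.2 := by
      simp [Matrix.mul_apply, hOb, hCt]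
    rw [this, Matrix.mul_assoc C, ← Matrix.mul_assoc (A ^ _), ← pow_add, ← Matrix.mul_assoc]
    simp [hankelMinus, hankel, markov]
  have hObr : Ob.rank = n :=
    rank_of_submatrix_rank (fun ka : Fin n × Fin m => (Fin.castLE hK₁ ka.1, ka.2)) hobs
  have hCtr : Ctᵀ.rank = n := by
    refine rank_of_submatrix_rank (fun ka : Fin n × Fin p => (Fin.castLE hK₂ ka.1, ka.2)) ?_
    rw [← Matrix.rank_transpose]
    exact hctr
  rw [Matrix.rank_transpose] at hCtr
  have htop : LinearMap.range Ct.mulVecLin = ⊤ := by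
    apply Submodule.eq_top_of_finrank_eq
    rw [← Matrix.rank, hCtr]; simp
  rw [hH, Matrix.rank, Matrix.mulVecLin_mul, LinearMap.range_comp_of_range_eq_top _ htop,
    ← Matrix.rank, hObr]

lemma sigma_pos_of_rank {ι κ : Type*} [Fintype ι] [Fintype κ] [DecidableEq ι] [DecidableEq κ]
    (hn : 0 < n) {M : Matrix ι κ ℝ} (h : M.rank = n) : 0 < sigma n M := by
  rw [sigma, LinearMap.singularValues_pos_iff_lt_finrank_range]
  have : Module.finrank ℝ (LinearMap.range (Matrix.toEuclideanLin M)) = M.rank := by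
    rw [Matrix.toEuclideanLin_eq_toLin_orthonormal, ← Matrix.rank_eq_finrank_range_toLin]
  rw [this, h]
  omega

lemma norm_submatrix_id_le {ι κ κ' : Type*} [Fintype ι] [Fintype κ] [Fintype κ'] [DecidableEq ι]
    [DecidableEq κ] [DecidableEq κ'] (M : Matrix ι κ ℝ) {f : κ' → κ} (hf : Function.Injective f) :
    ‖M.submatrix id f‖ ≤ ‖M‖ := by
  rw [← norm_transpose, ← norm_transpose M]
  refine norm_le_of_vnorm_mulVec (norm_nonneg _) fun x => le_trans ?_ (vnorm_mulVec_le _ _)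
  refine le_of_sq_le_sq ?_ (vnorm_nonneg _)
  rw [vnorm_sq_eq_sum, vnorm_sq_eq_sum]
  calc ∑ j, ‖((M.submatrix id f)ᵀ *ᵥ x) j‖ ^ 2
      = ∑ c ∈ Finset.univ.map ⟨f, hf⟩, ‖(Mᵀ *ᵥ x) c‖ ^ 2 := by
        rw [Finset.sum_map]; rfl
    _ ≤ _ := Finset.sum_le_univ_sum_of_nonneg fun c => by positivity

/-- A matrix with `K` block rows, each of them a selection of columns of `M`, has norm at most
`√K ‖M‖`. -/
lemma norm_blockRows_le {κ κ' : Type*} [Fintype κ] [Fintype κ'] [DecidableEq κ] [DecidableEq κ']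
    {K : ℕ} (M : Matrix (Fin m) κ ℝ) (f : Fin K → κ' → κ) (hf : ∀ i, Function.Injective (f i)) :
    ‖(Matrix.of fun (ia : Fin K × Fin m) j => M ia.2 (f ia.1 j) :
      Matrix (Fin K × Fin m) κ' ℝ)‖ ≤ √K * ‖M‖ := by
  refine norm_le_of_vnorm_mulVec (by positivity) fun x => ?_
  refine le_of_sq_le_sq ?_ (mul_nonneg (by positivity) (vnorm_nonneg _))
  rw [vnorm_sq_eq_sum, Fintype.sum_prod_type]
  calc _ = ∑ i, vnorm (M.submatrix id (f i) *ᵥ x) ^ 2 := by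
        simp_rw [vnorm_sq_eq_sum]; rfl
    _ ≤ ∑ _i : Fin K, (‖M‖ * vnorm x) ^ 2 := by
        refine Finset.sum_le_sum fun i _ => pow_le_pow_left₀ (vnorm_nonneg _) ?_ 2
        exact (vnorm_mulVec_le _ _).trans
          (mul_le_mul_of_nonneg_right (norm_submatrix_id_le M (hf i)) (vnorm_nonneg _))
    _ = _ := by
        rw [Finset.sum_const, Finset.card_univ, Fintype.card_fin, nsmul_eq_mul, mul_pow, mul_pow,
          mul_pow, Real.sq_sqrt (Nat.cast_nonneg _)]
        ring

lemma norm_hankelMinus_le (G : Matrix (Fin m) (Fin (K₁ + K₂ + 1) × Fin p) ℝ) :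
    ‖hankelMinus G‖ ≤ √K₁ * ‖G‖ :=
  norm_blockRows_le G (fun i (jb : Fin K₂ × Fin p) =>
    (⟨(i : ℕ) + (jb.1 : ℕ) + 1, by have := i.isLt; have := jb.1.isLt; omega⟩, jb.2))
    fun i a b h => by
      simp only [Prod.mk.injEq, Fin.mk.injEq] at h
      exact Prod.ext (Fin.ext (by omega)) h.2

lemma norm_hankelPlus_le (G : Matrix (Fin m) (Fin (K₁ + K₂ + 1) × Fin p) ℝ) :
    ‖hankelPlus G‖ ≤ √K₁ * ‖G‖ :=
  norm_blockRows_le G (fun i (jb : Fin K₂ × Fin p) =>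
    (⟨(i : ℕ) + ((jb.1 : ℕ) + 1) + 1, by have := i.isLt; have := jb.1.isLt; omega⟩, jb.2))
    fun i a b h => by
      simp only [Prod.mk.injEq, Fin.mk.injEq] at h
      exact Prod.ext (Fin.ext (by omega)) h.2

lemma eq_of_isBestRankApprox {ι κ : Type*} [Fintype ι] [Fintype κ] [DecidableEq ι] [DecidableEq κ]
    {r : ℕ} {M L : Matrix ι κ ℝ} (h : IsBestRankApprox r M L) (hM : M.rank ≤ r) : L = M := by
  have h1 := h.2 M hM
  rw [sub_self, norm_zero, norm_le_zero_iff, sub_eq_zero] at h1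
  exact h1.symm

/-- **Robustness of the Ho-Kalman algorithm**: if the Markov parameters are known up to
`ε / √K₁`, then so are the poles up to the stated bound. -/
theorem hoKalman_spectralDist_le (hn : 0 < n) (hK₁ : n ≤ K₁) (hK₂ : n ≤ K₂)
    {A : Matrix (Fin n) (Fin n) ℝ} {B : Matrix (Fin n) (Fin p) ℝ}
    {C : Matrix (Fin m) (Fin n) ℝ} {D : Matrix (Fin m) (Fin p) ℝ}
    (hobs : IsObservable A C) (hctr : IsControllable A B)
    {L Lhat : Matrix (Fin K₁ × Fin m) (Fin K₂ × Fin p) ℝ} {Abar Ahat : Matrix (Fin n) (Fin n) ℝ}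
    {Ghat : Matrix (Fin m) (Fin (K₁ + K₂ + 1) × Fin p) ℝ}
    (hAbar : IsHoKalmanOutput (markov (K₁ + K₂ + 1) A B C D) L Abar)
    (hAhat : IsHoKalmanOutput Ghat Lhat Ahat) {ε Δ : ℝ}
    (hε : √K₁ * ‖Ghat - markov (K₁ + K₂ + 1) A B C D‖ ≤ ε)
    (hcond : ‖L - Lhat‖ ≤ sigma n (hankelMinus (markov (K₁ + K₂ + 1) A B C D)) / 2 ∨
      4 * √(min K₁ K₂ : ℕ) * ε ≤ sigma n (hankelMinus (markov (K₁ + K₂ + 1) A B C D)))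
    (hΔ : Δ = 9 * √n / sigma n (hankelMinus (markov (K₁ + K₂ + 1) A B C D)) *
      (‖hankelPlus (markov (K₁ + K₂ + 1) A B C D)‖ /
        sigma n (hankelMinus (markov (K₁ + K₂ + 1) A B C D)) + 2) *
      √(min K₁ (K₂ + 1) : ℕ) * ε) :
    spectralDist Ahat Abar ≤ (Δ + 2 * ‖Abar‖) ^ (1 - 1 / (n : ℝ)) * Δ ^ (1 / (n : ℝ)) := by
  set G := markov (K₁ + K₂ + 1) A B C D with hG
  obtain ⟨hbest, O, Q, O', Q', hfac, hO', hQ', hA⟩ := hAbar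
  obtain ⟨hbesth, Oh, Qh, Oh', Qh', hfach, hOh', hQh', hAh⟩ := hAhat
  have hrank := rank_hankelMinus hK₁ hK₂ D hobs hctr
  rw [← hG] at hrank
  have hLH : L = hankelMinus G := eq_of_isBestRankApprox hbest hrank.le
  set σ := sigma n (hankelMinus G) with hσ
  have hσ0 : 0 < σ := sigma_pos_of_rank hn hrank
  have hε0 : 0 ≤ ε := le_trans (by positivity) hε
  have hminus : ‖hankelMinus Ghat - hankelMinus G‖ ≤ ε :=
    (norm_hankelMinus_le (Ghat - G)).trans hε
  have hplus : ‖hankelPlus Ghat - hankelPlus G‖ ≤ ε :=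
    (norm_hankelPlus_le (Ghat - G)).trans hε
  have he2 : ‖L - Lhat‖ ≤ 2 * ε := by
    have h1 := hbesth.2 (hankelMinus G) hrank.le
    rw [hLH]
    calc ‖hankelMinus G - Lhat‖
        = ‖(hankelMinus Ghat - Lhat) - (hankelMinus Ghat - hankelMinus G)‖ := by
          congr 1; abel
      _ ≤ ε + ε := (norm_sub_le _ _).trans (add_le_add (h1.trans hminus) hminus)
      _ = 2 * ε := by ring
  have hmin1 : (1 : ℝ) ≤ √(min K₁ K₂ : ℕ) := by
    rw [Real.one_le_sqrt]; exact_mod_cast (by omega : 1 ≤ min K₁ K₂)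
  have hmin2 : (1 : ℝ) ≤ √(min K₁ (K₂ + 1) : ℕ) := by
    rw [Real.one_le_sqrt]; exact_mod_cast (by omega : 1 ≤ min K₁ (K₂ + 1))
  have hsn : (1 : ℝ) ≤ √n := by
    rw [Real.one_le_sqrt]; exact_mod_cast hn
  have heσ : ‖L - Lhat‖ ≤ σ / 2 := by
    rcases hcond with h | h
    · exact h
    · nlinarith
  have hsq : √σ ^ 2 = σ := Real.sq_sqrt hσ0.le
  have hσL : sigma n L = σ := by rw [hLH]
  obtain ⟨T, S, hTS, hST, hle⟩ := exists_similar_state_near (Real.sqrt_pos.2 hσ0)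
    (fun x => hσL ▸ (hfac.lower_bounds x).1) (fun x => hσL ▸ (hfac.lower_bounds x).2)
    hO' hQ' hOh' hQh' hfac.eq_mul hfach.eq_mul le_rfl (by rw [hsq]; exact heσ) hplus
  rw [← hA, ← hAh] at hle
  refine spectralDist_le hn hTS hST (hle.trans ?_)
  have h4 : √σ ^ 4 = σ ^ 2 := by rw [show √σ ^ 4 = (√σ ^ 2) ^ 2 by ring, hsq]
  rw [h4, hsq]
  set h := ‖hankelPlus G‖ with hh
  have hh0 : 0 ≤ h := norm_nonneg _
  calc 2 * ε / σ + 4 * ‖L - Lhat‖ * h / σ ^ 2 ≤ 2 * ε / σ + 4 * (2 * ε) * h / σ ^ 2 := by gcongr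
    _ ≤ 9 * 1 / σ * (h / σ + 2) * 1 * ε := by
        rw [← sub_nonneg]
        have : 9 * 1 / σ * (h / σ + 2) * 1 * ε - (2 * ε / σ + 4 * (2 * ε) * h / σ ^ 2)
            = h * ε / σ ^ 2 + 16 * ε / σ := by field_simp; ring
        rw [this]; positivity
    _ ≤ 9 * √n / σ * (h / σ + 2) * √(min K₁ (K₂ + 1) : ℕ) * ε := by gcongr
    _ = Δ := hΔ.symm

end Hankel

/-! ### Nets of the unit sphere -/

section Nets

open Metric Module

open scoped Function in
/-- Volume bound: a set of points of the unit sphere at mutual distances larger than `1 / 10` has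
at most `21 ^ d` elements, because the balls of radius `1 / 20` around them are disjoint and lie
in the ball of radius `21 / 20`. -/
lemma card_le_of_separated_sphere {E : Type*} [NormedAddCommGroup E] [NormedSpace ℝ E]
    [FiniteDimensional ℝ E] (s : Finset E) (hs : ∀ c ∈ s, ‖c‖ = 1)
    (h : ∀ c ∈ s, ∀ d ∈ s, c ≠ d → 1 / 10 < ‖c - d‖) : s.card ≤ 21 ^ finrank ℝ E := by
  borelize E
  let μ : Measure E := Measure.addHaar
  set A := ⋃ c ∈ s, ball (c : E) (1 / 20) with hA
  have D : Set.Pairwise (s : Set E) (Disjoint on fun c => ball (c : E) (1 / 20)) := by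
    rintro c hc d hd hcd
    apply ball_disjoint_ball
    rw [dist_eq_norm]
    linarith [h c hc d hd hcd]
  have A_subset : A ⊆ ball (0 : E) (21 / 20) := by
    refine Set.iUnion₂_subset fun x hx => ball_subset_ball' ?_
    rw [dist_zero_right, hs x hx]
    norm_num
  have I : (s.card : ENNReal) * ENNReal.ofReal ((1 / 20) ^ finrank ℝ E) * μ (ball 0 1) ≤
      ENNReal.ofReal ((21 / 20) ^ finrank ℝ E) * μ (ball 0 1) :=
    calc
      (s.card : ENNReal) * ENNReal.ofReal ((1 / 20) ^ finrank ℝ E) * μ (ball 0 1) = μ A := by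
        rw [hA, measure_biUnion_finset D fun c _ => measurableSet_ball]
        have I : (0 : ℝ) < 1 / 20 := by norm_num
        simp only [μ.addHaar_ball_of_pos _ I]
        simp only [Finset.sum_const, nsmul_eq_mul, mul_assoc]
      _ ≤ μ (ball (0 : E) (21 / 20)) := measure_mono A_subset
      _ = ENNReal.ofReal ((21 / 20) ^ finrank ℝ E) * μ (ball 0 1) := by
        have I : (0 : ℝ) < 21 / 20 := by norm_num
        simp only [μ.addHaar_ball_of_pos _ I]
  have J : (s.card : ENNReal) * ENNReal.ofReal ((1 / 20) ^ finrank ℝ E)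
      ≤ ENNReal.ofReal ((21 / 20) ^ finrank ℝ E) :=
    (ENNReal.mul_le_mul_iff_left (measure_ball_pos _ _ zero_lt_one).ne' measure_ball_lt_top.ne).1 I
  have K : (s.card : ℝ) ≤ (21 : ℝ) ^ finrank ℝ E := by
    have h1 := ENNReal.toReal_le_of_le_ofReal (by positivity) J
    rw [ENNReal.toReal_mul, ENNReal.toReal_natCast, ENNReal.toReal_ofReal (by positivity)] at h1
    have h2 : (21 / 20 : ℝ) ^ finrank ℝ E = 21 ^ finrank ℝ E * (1 / 20) ^ finrank ℝ E := by
      rw [← mul_pow]; norm_num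
    rw [h2] at h1
    exact le_of_mul_le_mul_right h1 (by positivity)
  exact_mod_cast K

variable {ι κ : Type*} [Fintype ι] [Fintype κ]

variable (ι) in
/-- The unit sphere of `ι → ℝ` has a `1 / 10`-net with at most `21 ^ d` elements: a separated set
of maximal cardinality. -/
lemma exists_net : ∃ T : Finset (ι → ℝ), T.card ≤ 21 ^ Fintype.card ι ∧
    (∀ t ∈ T, vnorm t = 1) ∧ ∀ x, vnorm x = 1 → ∃ t ∈ T, vnorm (x - t) ≤ 1 / 10 := by
  classical
  let sep : Finset (EuclideanSpace ℝ ι) → Prop := fun s =>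
    (∀ c ∈ s, ‖c‖ = 1) ∧ ∀ c ∈ s, ∀ d ∈ s, c ≠ d → 1 / 10 < ‖c - d‖
  have hbdd : ∀ s, sep s → s.card ≤ 21 ^ Fintype.card ι := fun s hs => by
    simpa using card_le_of_separated_sphere s hs.1 hs.2
  let S : Set ℕ := {k | ∃ s, sep s ∧ s.card = k}
  have hS0 : S.Nonempty := ⟨0, ∅, by simp [sep], rfl⟩
  have hSb : BddAbove S := ⟨21 ^ Fintype.card ι, by rintro k ⟨s, hs, rfl⟩; exact hbdd s hs⟩
  obtain ⟨s, hs, hsk⟩ := Nat.sSup_mem hS0 hSb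
  refine ⟨s.map (WithLp.equiv 2 (ι → ℝ)).toEmbedding, ?_, ?_, ?_⟩
  · rw [Finset.card_map]; exact hbdd s hs
  · intro t ht
    obtain ⟨c, hc, rfl⟩ := Finset.mem_map.1 ht
    exact hs.1 c hc
  · intro x hx
    by_contra! hcon
    have hfar : ∀ c ∈ s, 1 / 10 < ‖WithLp.toLp 2 x - c‖ := fun c hc =>
      hcon _ (Finset.mem_map_of_mem _ hc)
    have hnot : WithLp.toLp 2 x ∉ s := fun hmem => by
      have := hfar _ hmem
      rw [sub_self, norm_zero] at this
      norm_num at this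
    have hins : sep (insert (WithLp.toLp 2 x) s) := by
      refine ⟨fun c hc => ?_, fun c hc d hd hcd => ?_⟩
      · rcases Finset.mem_insert.1 hc with rfl | hc
        · exact hx
        · exact hs.1 c hc
      · rcases Finset.mem_insert.1 hc with h1 | hc <;> rcases Finset.mem_insert.1 hd with h2 | hd
        · exact absurd (h1.trans h2.symm) hcd
        · rw [h1]; exact hfar d hd
        · rw [h2, norm_sub_rev]; exact hfar c hc
        · exact hs.2 c hc d hd hcd
    have := le_csSup hSb ⟨_, hins, rfl⟩
    rw [Finset.card_insert_of_notMem hnot, hsk] at this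
    omega

variable [DecidableEq κ]

lemma norm_le_of_unit {X : Matrix ι κ ℝ} {r : ℝ} (hr : 0 ≤ r)
    (h : ∀ x, vnorm x = 1 → vnorm (X *ᵥ x) ≤ r) : ‖X‖ ≤ r := by
  refine norm_le_of_vnorm_mulVec hr fun x => ?_
  rcases (vnorm_nonneg x).eq_or_lt with h0 | h0
  · rw [vnorm_eq_zero.1 h0.symm]; simp
  · have h1 := h ((vnorm x)⁻¹ • x) (by
      rw [vnorm_smul, norm_inv, Real.norm_of_nonneg h0.le, inv_mul_cancel₀ h0.ne'])
    rw [Matrix.mulVec_smul, vnorm_smul, norm_inv, Real.norm_of_nonneg h0.le,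
      inv_mul_le_iff₀ h0] at h1
    linarith

lemma norm_le_of_net {X : Matrix ι κ ℝ} {T : Finset (κ → ℝ)} {a : ℝ} (ha : 0 ≤ a)
    (hT : ∀ x, vnorm x = 1 → ∃ t ∈ T, vnorm (x - t) ≤ 1 / 10)
    (h : ∀ t ∈ T, vnorm (X *ᵥ t) ≤ a) : ‖X‖ ≤ 10 / 9 * a := by
  have h1 : ‖X‖ ≤ a + ‖X‖ * (1 / 10) := by
    refine norm_le_of_unit (by positivity) fun x hx => ?_
    obtain ⟨t, ht, hxt⟩ := hT x hx
    have e : X *ᵥ x = X *ᵥ t + X *ᵥ (x - t) := by rw [← Matrix.mulVec_add]; congr 1; abel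
    rw [e]
    refine (vnorm_add_le _ _).trans (add_le_add (h t ht) ((vnorm_mulVec_le _ _).trans ?_))
    gcongr
  linarith

lemma lower_bound_of_net {X : Matrix ι κ ℝ} {T : Finset (κ → ℝ)} {a b : ℝ}
    (hT : ∀ x, vnorm x = 1 → ∃ t ∈ T, vnorm (x - t) ≤ 1 / 10)
    (h : ∀ t ∈ T, a ≤ vnorm (X *ᵥ t)) (hb : ‖X‖ ≤ b) (x : κ → ℝ) :
    (a - b / 10) * vnorm x ≤ vnorm (X *ᵥ x) := by
  have key : ∀ x, vnorm x = 1 → a - b / 10 ≤ vnorm (X *ᵥ x) := fun x hx => by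
    obtain ⟨t, ht, hxt⟩ := hT x hx
    have e : X *ᵥ t = X *ᵥ x - X *ᵥ (x - t) := by rw [← Matrix.mulVec_sub]; congr 1; abel
    have h1 := h t ht
    rw [e] at h1
    have h2 := h1.trans (vnorm_sub_le _ _)
    have h3 : vnorm (X *ᵥ (x - t)) ≤ b * (1 / 10) := (vnorm_mulVec_le _ _).trans
      (mul_le_mul hb hxt (vnorm_nonneg _) ((norm_nonneg _).trans hb))
    linarith
  rcases (vnorm_nonneg x).eq_or_lt with h0 | h0
  · rw [← h0, mul_zero]; exact vnorm_nonneg _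
  · have h1 := key ((vnorm x)⁻¹ • x) (by
      rw [vnorm_smul, norm_inv, Real.norm_of_nonneg h0.le, inv_mul_cancel₀ h0.ne'])
    rw [Matrix.mulVec_smul, vnorm_smul, norm_inv, Real.norm_of_nonneg h0.le,
      le_inv_mul_iff₀ h0] at h1
    linarith

lemma norm_le_of_nets {X : Matrix ι κ ℝ} {S : Finset (ι → ℝ)} {T : Finset (κ → ℝ)} {a : ℝ}
    (ha : 0 ≤ a) (hS : ∀ y, vnorm y = 1 → ∃ s ∈ S, vnorm (y - s) ≤ 1 / 10)
    (hT1 : ∀ t ∈ T, vnorm t = 1) (hT : ∀ x, vnorm x = 1 → ∃ t ∈ T, vnorm (x - t) ≤ 1 / 10)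
    (h : ∀ s ∈ S, ∀ t ∈ T, s ⬝ᵥ X *ᵥ t ≤ a) : ‖X‖ ≤ 5 / 4 * a := by
  have h1 : ‖X‖ ≤ a + ‖X‖ * (1 / 5) := by
    refine norm_le_of_unit (by positivity) fun x hx => ?_
    obtain ⟨t, ht, hxt⟩ := hT x hx
    set r := a + ‖X‖ * (1 / 5) with hr
    rcases (vnorm_nonneg (X *ᵥ x)).eq_or_lt with h0 | h0
    · rw [← h0]; positivity
    set y := (vnorm (X *ᵥ x))⁻¹ • (X *ᵥ x) with hy
    have hy1 : vnorm y = 1 := by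
      rw [hy, vnorm_smul, norm_inv, Real.norm_of_nonneg h0.le, inv_mul_cancel₀ h0.ne']
    have hyX : y ⬝ᵥ X *ᵥ x = vnorm (X *ᵥ x) := by
      rw [hy, smul_dotProduct, ← vnorm_sq, smul_eq_mul, sq, inv_mul_cancel_left₀ h0.ne']
    obtain ⟨s, hs, hys⟩ := hS y hy1
    have e : y ⬝ᵥ X *ᵥ x = s ⬝ᵥ X *ᵥ t + (y - s) ⬝ᵥ X *ᵥ t + y ⬝ᵥ X *ᵥ (x - t) := by
      rw [sub_dotProduct, Matrix.mulVec_sub, dotProduct_sub]; ring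
    have b1 : (y - s) ⬝ᵥ X *ᵥ t ≤ 1 / 10 * (‖X‖ * 1) := by
      refine (dotProduct_le_vnorm _ _).trans (mul_le_mul hys ?_ (vnorm_nonneg _) (by norm_num))
      rw [← hT1 t ht]; exact vnorm_mulVec_le _ _
    have b2 : y ⬝ᵥ X *ᵥ (x - t) ≤ 1 * (‖X‖ * (1 / 10)) := by
      refine (dotProduct_le_vnorm _ _).trans (mul_le_mul hy1.le ?_ (vnorm_nonneg _) (by norm_num))
      exact (vnorm_mulVec_le _ _).trans (by gcongr)
    rw [← hyX, e, hr]
    linarith [h s hs t ht]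
  linarith

end Nets

/-! ### Linear functionals of independent Gaussian vectors -/

section Gaussian

open scoped InnerProductSpace

variable {Ω Q : Type*} [MeasurableSpace Ω] [Fintype Q] {P : Measure Ω} {d : ℕ} {σ : ℝ}
  {ξ : Q → Ω → EuclideanSpace ℝ (Fin d)}

lemma posSemidef_sq_smul_one (σ : ℝ) (d : ℕ) :
    (σ ^ 2 • (1 : Matrix (Fin d) (Fin d) ℝ)).PosSemidef :=
  Matrix.PosSemidef.one.smul (sq_nonneg σ)

lemma covariance_inner_gaussian {X : Ω → EuclideanSpace ℝ (Fin d)}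
    (hX : HasLaw X (multivariateGaussian 0 (σ ^ 2 • (1 : Matrix _ _ ℝ))) P)
    (a b : EuclideanSpace ℝ (Fin d)) :
    cov[fun ω => ⟪a, X ω⟫_ℝ, fun ω => ⟪b, X ω⟫_ℝ; P] = σ ^ 2 * ⟪a, b⟫_ℝ := by
  have h1 : cov[fun ω => ⟪a, X ω⟫_ℝ, fun ω => ⟪b, X ω⟫_ℝ; P]
      = cov[fun x => ⟪a, x⟫_ℝ, fun x => ⟪b, x⟫_ℝ;
        multivariateGaussian 0 (σ ^ 2 • (1 : Matrix (Fin d) (Fin d) ℝ))] :=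
    hX.covariance_comp (by fun_prop) (by fun_prop)
  rw [h1, ← covarianceBilin_apply_eq_cov IsGaussian.memLp_two_id,
    covarianceBilin_multivariateGaussian (posSemidef_sq_smul_one σ d), Matrix.smul_mulVec,
    Matrix.one_mulVec, dotProduct_smul, smul_eq_mul, EuclideanSpace.inner_eq_star_dotProduct,
    star_trivial, dotProduct_comm]

lemma integral_inner_gaussian {X : Ω → EuclideanSpace ℝ (Fin d)}
    (hX : HasLaw X (multivariateGaussian 0 (σ ^ 2 • (1 : Matrix _ _ ℝ))) P)
    (a : EuclideanSpace ℝ (Fin d)) : ∫ ω, ⟪a, X ω⟫_ℝ ∂P = 0 := by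
  have h1 : ∫ ω, ⟪a, X ω⟫_ℝ ∂P = ∫ x, ⟪a, x⟫_ℝ
      ∂(multivariateGaussian 0 (σ ^ 2 • (1 : Matrix (Fin d) (Fin d) ℝ))) :=
    hX.integral_comp (f := fun x => ⟪a, x⟫_ℝ) (by fun_prop)
  rw [h1, integral_inner IsGaussian.integrable_fun_id, integral_id_multivariateGaussian,
    inner_zero_right]

/-- The linear functional `∑ ⟨c_q, ξ_q⟩` of a family of vectors. -/
noncomputable def linForm (c : Q → EuclideanSpace ℝ (Fin d)) (z : Q → EuclideanSpace ℝ (Fin d)) :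
    ℝ := ∑ q, ⟪c q, z q⟫_ℝ

lemma hasGaussianLaw_inner {X : Ω → EuclideanSpace ℝ (Fin d)}
    (hX : HasLaw X (multivariateGaussian 0 (σ ^ 2 • (1 : Matrix _ _ ℝ))) P)
    (a : EuclideanSpace ℝ (Fin d)) : HasGaussianLaw (fun ω => ⟪a, X ω⟫_ℝ) P :=
  hX.hasGaussianLaw.map_fun (innerSL ℝ a)

lemma covariance_linForm
    (hlaw : ∀ q, HasLaw (ξ q) (multivariateGaussian 0 (σ ^ 2 • (1 : Matrix _ _ ℝ))) P)
    (hind : iIndepFun ξ P) (c c' : Q → EuclideanSpace ℝ (Fin d)) :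
    cov[fun ω => linForm c fun q => ξ q ω, fun ω => linForm c' fun q => ξ q ω; P]
      = σ ^ 2 * ∑ q, ⟪c q, c' q⟫_ℝ := by
  have := hind.isProbabilityMeasure
  have hL := fun (a : EuclideanSpace ℝ (Fin d)) q => (hasGaussianLaw_inner (hlaw q) a).memLp_two
  unfold linForm
  rw [covariance_fun_sum_fun_sum (fun q => hL (c q) q) (fun q => hL (c' q) q), Finset.mul_sum]
  refine Finset.sum_congr rfl fun q _ => ?_
  rw [Finset.sum_eq_single q (fun r _ hr => ?_) (by simp), covariance_inner_gaussian (hlaw q)]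
  refine IndepFun.covariance_eq_zero ?_ (hL (c q) q) (hL (c' r) r)
  exact (hind.indepFun hr.symm).comp (φ := fun x => ⟪c q, x⟫_ℝ) (ψ := fun x => ⟪c' r, x⟫_ℝ)
    (by fun_prop) (by fun_prop)

lemma hasLaw_linForm
    (hlaw : ∀ q, HasLaw (ξ q) (multivariateGaussian 0 (σ ^ 2 • (1 : Matrix _ _ ℝ))) P)
    (hind : iIndepFun ξ P) (c : Q → EuclideanSpace ℝ (Fin d)) :
    HasLaw (fun ω => linForm c fun q => ξ q ω)
      (gaussianReal 0 (σ ^ 2 * ∑ q, ‖c q‖ ^ 2).toNNReal) P := by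
  have hprob := hind.isProbabilityMeasure
  have hg : HasGaussianLaw (fun ω => linForm c fun q => ξ q ω) P := by
    refine iIndepFun.hasGaussianLaw_fun_sum (fun q => hasGaussianLaw_inner (hlaw q) (c q)) ?_
    exact hind.comp (fun q x => ⟪c q, x⟫_ℝ) (fun q => by fun_prop)
  refine ⟨hg.aemeasurable, ?_⟩
  rw [hg.map_eq_gaussianReal]
  congr 2
  · unfold linForm
    rw [integral_finsetSum _ fun q _ => (hasGaussianLaw_inner (hlaw q) (c q)).integrable]
    exact Finset.sum_eq_zero fun q _ => integral_inner_gaussian (hlaw q) (c q)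
  · rw [← covariance_self hg.aemeasurable, covariance_linForm hlaw hind]
    simp

/-- Linear functionals with orthogonal coefficient vectors are independent. -/
lemma iIndepFun_linForm {J : Type*} [Fintype J]
    (hlaw : ∀ q, HasLaw (ξ q) (multivariateGaussian 0 (σ ^ 2 • (1 : Matrix _ _ ℝ))) P)
    (hind : iIndepFun ξ P) (c : J → Q → EuclideanSpace ℝ (Fin d))
    (horth : ∀ i j, i ≠ j → ∑ q, ⟪c i q, c j q⟫_ℝ = 0) :
    iIndepFun (fun j ω => linForm (c j) fun q => ξ q ω) P := by
  have hg : HasGaussianLaw (fun ω => (fun q => ξ q ω)) P :=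
    hind.hasGaussianLaw fun q => (hlaw q).hasGaussianLaw
  let Λ : (Q → EuclideanSpace ℝ (Fin d)) →L[ℝ] (J → ℝ) := ContinuousLinearMap.pi fun j =>
    ∑ q, (innerSL ℝ (c j q)).comp (ContinuousLinearMap.proj q)
  have hJ : HasGaussianLaw (fun ω j => linForm (c j) fun q => ξ q ω) P := by
    have h1 := hg.map_fun Λ
    have h2 : (fun ω => Λ fun q => ξ q ω) = fun ω j => linForm (c j) fun q => ξ q ω := by
      ext ω j
      simp [Λ, linForm]
    rwa [h2] at h1
  refine hJ.iIndepFun_of_covariance_eq_zero fun i j hij => ?_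
  rw [covariance_linForm hlaw hind, horth i j hij, mul_zero]

/-- Gaussian tail bound for a linear functional of variance at most `s`. -/
lemma measureReal_linForm_ge_le
    (hlaw : ∀ q, HasLaw (ξ q) (multivariateGaussian 0 (σ ^ 2 • (1 : Matrix _ _ ℝ))) P)
    (hind : iIndepFun ξ P) (c : Q → EuclideanSpace ℝ (Fin d)) {s τ : ℝ} (hτ : 0 ≤ τ)
    (hs : σ ^ 2 * ∑ q, ‖c q‖ ^ 2 ≤ s) :
    P.real {ω | τ ≤ linForm c fun q => ξ q ω} ≤ Real.exp (-τ ^ 2 / (2 * s)) := by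
  have hl := hasLaw_linForm hlaw hind c
  have h0 : 0 ≤ σ ^ 2 * ∑ q, ‖c q‖ ^ 2 := by positivity
  have hsub : HasSubgaussianMGF (fun ω => linForm c fun q => ξ q ω) s.toNNReal P := by
    constructor
    · intro t
      have h1 := integrable_exp_mul_gaussianReal (μ := 0)
        (v := (σ ^ 2 * ∑ q, ‖c q‖ ^ 2).toNNReal) t
      rw [← hl.map_eq] at h1
      exact h1.comp_aemeasurable hl.aemeasurable
    · intro t
      rw [mgf_gaussianReal hl.map_eq, zero_mul, zero_add, Real.coe_toNNReal _ h0,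
        Real.coe_toNNReal _ (h0.trans hs)]
      gcongr
  have := hsub.measure_ge_le hτ
  rwa [Real.coe_toNNReal _ (h0.trans hs)] at this

/-- The tail bound with random coefficients that are independent of the Gaussian family. -/
lemma measure_linForm_ge_le_of_indep {𝓤 : Type*} [MeasurableSpace 𝓤]
    (hlaw : ∀ q, HasLaw (ξ q) (multivariateGaussian 0 (σ ^ 2 • (1 : Matrix _ _ ℝ))) P)
    (hind : iIndepFun ξ P) {Y : Ω → 𝓤} (hY : AEMeasurable Y P)
    (hYξ : IndepFun Y (fun ω q => ξ q ω) P)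
    {c : 𝓤 → Q → EuclideanSpace ℝ (Fin d)} (hc : ∀ q, Measurable fun y => c y q)
    {s τ : ℝ} (hτ : 0 ≤ τ) :
    P {ω | σ ^ 2 * ∑ q, ‖c (Y ω) q‖ ^ 2 ≤ s ∧ τ ≤ linForm (c (Y ω)) fun q => ξ q ω}
      ≤ ENNReal.ofReal (Real.exp (-τ ^ 2 / (2 * s))) := by
  have := hind.isProbabilityMeasure
  have hξ : AEMeasurable (fun ω q => ξ q ω) P :=
    aemeasurable_pi_lambda _ fun q => (hlaw q).aemeasurable
  let S : Set (𝓤 × (Q → EuclideanSpace ℝ (Fin d))) :=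
    {z | σ ^ 2 * ∑ q, ‖c z.1 q‖ ^ 2 ≤ s ∧ τ ≤ linForm (c z.1) z.2}
  have hS : MeasurableSet S := by
    have hc' : ∀ q, Measurable fun z : 𝓤 × (Q → EuclideanSpace ℝ (Fin d)) => c z.1 q :=
      fun q => (hc q).comp measurable_fst
    have hz : ∀ q, Measurable fun z : 𝓤 × (Q → EuclideanSpace ℝ (Fin d)) => z.2 q :=
      fun q => (measurable_pi_apply q).comp measurable_snd
    have m1 : Measurable fun z : 𝓤 × (Q → EuclideanSpace ℝ (Fin d)) =>
        σ ^ 2 * ∑ q, ‖c z.1 q‖ ^ 2 :=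
      measurable_const.mul (Finset.measurable_sum _ fun q _ => (hc' q).norm.pow_const 2)
    have m2 : Measurable fun z : 𝓤 × (Q → EuclideanSpace ℝ (Fin d)) => linForm (c z.1) z.2 := by
      unfold linForm
      exact Finset.measurable_sum _ fun q _ => Measurable.inner (𝕜 := ℝ) (hc' q) (hz q)
    exact (measurableSet_le m1 measurable_const).inter (measurableSet_le measurable_const m2)
  have h1 : P {ω | σ ^ 2 * ∑ q, ‖c (Y ω) q‖ ^ 2 ≤ s ∧ τ ≤ linForm (c (Y ω)) fun q => ξ q ω}
      = (P.map fun ω => (Y ω, fun q => ξ q ω)) S := by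
    rw [Measure.map_apply_of_aemeasurable (hY.prodMk hξ) hS]
    rfl
  have := Measure.isProbabilityMeasure_map hY
  have := Measure.isProbabilityMeasure_map hξ
  rw [h1, (indepFun_iff_map_prod_eq_prod_map_map hY hξ).1 hYξ, Measure.prod_apply hS]
  have hbound : ∀ y, (P.map fun ω q => ξ q ω) (Prod.mk y ⁻¹' S)
      ≤ ENNReal.ofReal (Real.exp (-τ ^ 2 / (2 * s))) := fun y => by
    by_cases hy : σ ^ 2 * ∑ q, ‖c y q‖ ^ 2 ≤ s
    · rw [Measure.map_apply_of_aemeasurable hξ (measurable_prodMk_left hS)]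
      have h2 : (fun ω q => ξ q ω) ⁻¹' (Prod.mk y ⁻¹' S)
          = {ω | τ ≤ linForm (c y) fun q => ξ q ω} := by
        ext ω; simp [S, hy]
      rw [h2, ← ofReal_measureReal]
      exact ENNReal.ofReal_le_ofReal (measureReal_linForm_ge_le hlaw hind (c y) hτ hy)
    · have h2 : Prod.mk y ⁻¹' S = ∅ := by
        ext z; simp [S, hy]
      rw [h2, measure_empty]
      exact zero_le
  calc _ ≤ ∫⁻ _, ENNReal.ofReal (Real.exp (-τ ^ 2 / (2 * s))) ∂(P.map Y) :=
        lintegral_mono hbound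
    _ = _ := by rw [lintegral_const, measure_univ, mul_one]

end Gaussian

/-! ### Chi-square tails -/

section ChiSquare

variable {Ω : Type*} [MeasurableSpace Ω] {P : Measure Ω}

lemma mgf_sq_gaussian {g : Ω → ℝ} {σ t : ℝ} (hσ : 0 < σ)
    (hg : HasLaw g (gaussianReal 0 (σ ^ 2).toNNReal) P) (ht : 0 < 1 - 2 * σ ^ 2 * t) :
    mgf (fun ω => g ω ^ 2) P t = √(1 / (1 - 2 * σ ^ 2 * t)) := by
  have hv : (σ ^ 2).toNNReal ≠ 0 := by
    simpa using hσ.ne'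
  have h1 : mgf (fun ω => g ω ^ 2) P t
      = ∫ x, Real.exp (t * x ^ 2) ∂(gaussianReal 0 (σ ^ 2).toNNReal) :=
    hg.integral_comp (f := fun x => Real.exp (t * x ^ 2)) (by fun_prop)
  rw [h1, integral_gaussianReal_eq_integral_smul hv]
  have h2 : ∀ x : ℝ, gaussianPDFReal 0 (σ ^ 2).toNNReal x • Real.exp (t * x ^ 2)
      = (√(2 * Real.pi * σ ^ 2))⁻¹ * Real.exp (-((1 - 2 * σ ^ 2 * t) / (2 * σ ^ 2)) * x ^ 2) := by
    intro x
    rw [gaussianPDFReal, Real.coe_toNNReal _ (sq_nonneg σ), smul_eq_mul, mul_assoc, ← Real.exp_add]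
    congr 2
    field_simp
    ring
  simp_rw [h2]
  rw [integral_const_mul, integral_gaussian, ← Real.sqrt_inv, ← Real.sqrt_mul (by positivity)]
  congr 1
  field_simp

variable {J : Type*} [Fintype J] {g : J → Ω → ℝ} {σ : ℝ}

lemma mgf_sum_sq_gaussian {t : ℝ} (hσ : 0 < σ)
    (hg : ∀ i, HasLaw (g i) (gaussianReal 0 (σ ^ 2).toNNReal) P) (hind : iIndepFun g P)
    (ht : 0 < 1 - 2 * σ ^ 2 * t) :
    mgf (fun ω => ∑ i, g i ω ^ 2) P t = √(1 / (1 - 2 * σ ^ 2 * t)) ^ Fintype.card J ∧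
      Integrable (fun ω => Real.exp (t * ∑ i, g i ω ^ 2)) P := by
  have h1 : mgf (fun ω => ∑ i, g i ω ^ 2) P t
      = √(1 / (1 - 2 * σ ^ 2 * t)) ^ Fintype.card J := by
    have hind' : iIndepFun (fun i ω => g i ω ^ 2) P :=
      hind.comp (fun _ x => x ^ 2) fun _ => by fun_prop
    have h := hind'.mgf_sum₀ (t := t) (fun i => (hg i).aemeasurable.pow_const 2) Finset.univ
    have e : (∑ i, fun ω => g i ω ^ 2) = fun ω => ∑ i, g i ω ^ 2 := by ext ω; simp
    rw [e] at h
    rw [h]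
    simp_rw [fun i => mgf_sq_gaussian hσ (hg i) ht]
    simp
  refine ⟨h1, ?_⟩
  -- The Bochner integral of a non-integrable function vanishes, but here it is positive.
  by_contra hni
  rw [mgf, integral_undef hni] at h1
  have : 0 < √(1 / (1 - 2 * σ ^ 2 * t)) ^ Fintype.card J := by positivity
  exact this.ne h1

lemma measureReal_sum_sq_le (hσ : 0 < σ)
    (hg : ∀ i, HasLaw (g i) (gaussianReal 0 (σ ^ 2).toNNReal) P) (hind : iIndepFun g P) :
    P.real {ω | ∑ i, g i ω ^ 2 ≤ 4 / 25 * σ ^ 2 * Fintype.card J}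
      ≤ Real.exp (-(9 / 20) * Fintype.card J) := by
  have := hind.isProbabilityMeasure
  -- The minimizer of the Chernoff bound: `1 - 2 σ² t = 25 / 4`.
  set t : ℝ := -(21 / 8) / σ ^ 2 with ht
  have e1 : 1 - 2 * σ ^ 2 * t = 25 / 4 := by rw [ht]; field_simp; norm_num
  obtain ⟨h1, h2⟩ := mgf_sum_sq_gaussian (t := t) hσ hg hind (by rw [e1]; norm_num)
  have ht0 : t ≤ 0 := by rw [ht]; exact div_nonpos_of_nonpos_of_nonneg (by norm_num) (sq_nonneg _)
  refine (measure_le_le_exp_mul_mgf _ ht0 h2).trans ?_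
  have e2 : √(1 / (25 / 4 : ℝ)) = 2 / 5 := by
    rw [Real.sqrt_eq_iff_mul_self_eq] <;> norm_num
  have e3 : -t * (4 / 25 * σ ^ 2 * Fintype.card J) = Fintype.card J * (21 / 50) := by
    rw [ht]; field_simp; ring
  have e4 : -(9 / 20 : ℝ) * Fintype.card J = Fintype.card J * (-(9 / 20)) := mul_comm _ _
  rw [h1, e1, e2, e3, e4, Real.exp_nat_mul, Real.exp_nat_mul, ← mul_pow]
  refine pow_le_pow_left₀ (by positivity) ?_ _
  have e5 : Real.exp (87 / 100) ≤ 5 / 2 := by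
    refine le_of_pow_le_pow_left₀ (n := 100) (by norm_num) (by norm_num) ?_
    rw [← Real.exp_nat_mul]
    have : ((100 : ℕ) : ℝ) * (87 / 100) = (87 : ℕ) * 1 := by norm_num
    rw [this, Real.exp_nat_mul]
    calc Real.exp 1 ^ 87 ≤ 2.72 ^ 87 :=
          pow_le_pow_left₀ (Real.exp_pos _).le (by linarith [Real.exp_one_lt_d9]) _
      _ ≤ _ := by norm_num
  have e6 : Real.exp (21 / 50) = Real.exp (87 / 100) * Real.exp (-(9 / 20)) := by
    rw [← Real.exp_add]; norm_num
  rw [e6]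
  nlinarith [Real.exp_pos (-(9 / 20) : ℝ)]

lemma measureReal_le_sum_sq (hσ : 0 < σ)
    (hg : ∀ i, HasLaw (g i) (gaussianReal 0 (σ ^ 2).toNNReal) P) (hind : iIndepFun g P) :
    P.real {ω | 81 / 25 * σ ^ 2 * Fintype.card J ≤ ∑ i, g i ω ^ 2}
      ≤ Real.exp (-(9 / 20) * Fintype.card J) := by
  have := hind.isProbabilityMeasure
  -- The minimizer of the Chernoff bound: `1 - 2 σ² t = 25 / 81`.
  set t : ℝ := 28 / 81 / σ ^ 2 with ht
  have e1 : 1 - 2 * σ ^ 2 * t = 25 / 81 := by rw [ht]; field_simp; norm_num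
  obtain ⟨h1, h2⟩ := mgf_sum_sq_gaussian (t := t) hσ hg hind (by rw [e1]; norm_num)
  refine (measure_ge_le_exp_mul_mgf _ (by positivity) h2).trans ?_
  have e2 : √(1 / (25 / 81 : ℝ)) = 9 / 5 := by
    rw [Real.sqrt_eq_iff_mul_self_eq] <;> norm_num
  have e3 : -t * (81 / 25 * σ ^ 2 * Fintype.card J) = Fintype.card J * (-(28 / 25)) := by
    rw [ht]; field_simp
  have e4 : -(9 / 20 : ℝ) * Fintype.card J = Fintype.card J * (-(9 / 20)) := mul_comm _ _
  rw [h1, e1, e2, e3, e4, Real.exp_nat_mul, Real.exp_nat_mul, ← mul_pow]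
  refine pow_le_pow_left₀ (by positivity) ?_ _
  have e5 : 9 / 5 ≤ Real.exp (67 / 100) := by
    refine le_of_pow_le_pow_left₀ (n := 100) (by norm_num) (Real.exp_pos _).le ?_
    rw [← Real.exp_nat_mul]
    have : ((100 : ℕ) : ℝ) * (67 / 100) = (67 : ℕ) * 1 := by norm_num
    rw [this, Real.exp_nat_mul]
    calc (9 / 5 : ℝ) ^ 100 ≤ 2.7 ^ 67 := by norm_num
      _ ≤ _ := pow_le_pow_left₀ (by norm_num) (by linarith [Real.exp_one_gt_d9]) _
  have e6 : Real.exp (-(9 / 20)) = Real.exp (67 / 100) * Real.exp (-(28 / 25)) := by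
    rw [← Real.exp_add]; norm_num
  rw [e6]
  nlinarith [Real.exp_pos (-(28 / 25) : ℝ)]

end ChiSquare

/-! ### Persistent excitation -/

section Excitation

variable {Ω : Type*} [MeasurableSpace Ω] {P : Measure Ω} {p N K : ℕ} {σ : ℝ}

/-- The matrix whose `i`-th row is the last column of the `i`-th Toeplitz block: all inputs of the
`i`-th trajectory, in reverse order. Unlike the columns of the Toeplitz block, its rows are
independent. -/
def lastColumns (u : Fin N → Fin K → EuclideanSpace ℝ (Fin p)) :
    Matrix (Fin N) (Fin K × Fin p) ℝ :=
  Matrix.of fun i la => u i la.1.rev la.2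

/-- The coefficients that express the `i`-th entry of `lastColumns u *ᵥ t` as a linear form in
all inputs. -/
noncomputable def lastCoeff (t : Fin K × Fin p → ℝ) (i : Fin N) (q : Fin N × Fin K) :
    EuclideanSpace ℝ (Fin p) :=
  if q.1 = i then WithLp.toLp 2 fun a => t (q.2.rev, a) else 0

lemma lastColumns_mulVec (u : Fin N → Fin K → EuclideanSpace ℝ (Fin p)) (t : Fin K × Fin p → ℝ)
    (i : Fin N) : (lastColumns u *ᵥ t) i = linForm (lastCoeff t i) fun q => u q.1 q.2 := by
  rw [linForm, Fintype.sum_prod_type, Finset.sum_eq_single i (fun j _ hj => by simp [lastCoeff, hj])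
    (by simp), Matrix.mulVec, dotProduct, Fintype.sum_prod_type, ← Equiv.sum_comp Fin.revPerm]
  refine Finset.sum_congr rfl fun k _ => ?_
  simp [lastCoeff, lastColumns, PiLp.inner_apply, mul_comm]

lemma sum_norm_lastCoeff (t : Fin K × Fin p → ℝ) (i : Fin N) :
    ∑ q, ‖lastCoeff t i q‖ ^ 2 = vnorm t ^ 2 := by
  rw [Fintype.sum_prod_type, Finset.sum_eq_single i (fun j _ hj => by simp [lastCoeff, hj])
    (by simp), vnorm_sq_eq_sum, Fintype.sum_prod_type, ← Equiv.sum_comp Fin.revPerm]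
  refine Finset.sum_congr rfl fun k _ => ?_
  simp [lastCoeff, EuclideanSpace.norm_sq_eq]

lemma measure_lastColumns_mulVec (hσ : 0 < σ) {u : Fin N → Fin K → Ω → EuclideanSpace ℝ (Fin p)}
    (hlaw : ∀ i k, HasLaw (u i k) (multivariateGaussian 0 (σ ^ 2 • (1 : Matrix _ _ ℝ))) P)
    (hind : iIndepFun (fun q : Fin N × Fin K => u q.1 q.2) P)
    {t : Fin K × Fin p → ℝ} (ht : vnorm t = 1) :
    P {ω | ¬ (2 / 5 * σ * √N ≤ vnorm (lastColumns (fun i k => u i k ω) *ᵥ t) ∧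
        vnorm (lastColumns (fun i k => u i k ω) *ᵥ t) ≤ 9 / 5 * σ * √N)}
      ≤ ENNReal.ofReal (2 * Real.exp (-(9 / 20) * N)) := by
  have hprob := hind.isProbabilityMeasure
  set g : Fin N → Ω → ℝ := fun i ω => linForm (lastCoeff t i) fun q : Fin N × Fin K => u q.1 q.2 ω
    with hgdef
  have hg : ∀ i, HasLaw (g i) (gaussianReal 0 (σ ^ 2).toNNReal) P := fun i => by
    have h := hasLaw_linForm (fun q : Fin N × Fin K => hlaw q.1 q.2) hind (lastCoeff t i)
    rwa [sum_norm_lastCoeff, ht, one_pow, mul_one] at h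
  have hgi : iIndepFun g P := by
    refine iIndepFun_linForm (fun q : Fin N × Fin K => hlaw q.1 q.2) hind _ fun i j hij => ?_
    refine Finset.sum_eq_zero fun q _ => ?_
    unfold lastCoeff
    by_cases h1 : q.1 = i
    · rw [if_neg (h1 ▸ hij : ¬ q.1 = j), inner_zero_right]
    · rw [if_neg h1, inner_zero_left]
  have hsq : ∀ ω, vnorm (lastColumns (fun i k => u i k ω) *ᵥ t) ^ 2 = ∑ i, g i ω ^ 2 := fun ω => by
    rw [vnorm_sq_eq_sum]
    refine Finset.sum_congr rfl fun i _ => ?_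
    rw [lastColumns_mulVec, Real.norm_eq_abs, sq_abs]
  have hlow := measureReal_sum_sq_le hσ hg hgi
  have hupp := measureReal_le_sum_sq hσ hg hgi
  rw [Fintype.card_fin] at hlow hupp
  have hN : √(N : ℝ) ^ 2 = N := Real.sq_sqrt (Nat.cast_nonneg _)
  calc P {ω | ¬ (2 / 5 * σ * √N ≤ vnorm (lastColumns (fun i k => u i k ω) *ᵥ t) ∧
        vnorm (lastColumns (fun i k => u i k ω) *ᵥ t) ≤ 9 / 5 * σ * √N)}
      ≤ P ({ω | ∑ i, g i ω ^ 2 ≤ 4 / 25 * σ ^ 2 * N} ∪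
          {ω | 81 / 25 * σ ^ 2 * N ≤ ∑ i, g i ω ^ 2}) := by
        refine measure_mono fun ω hω => ?_
        rw [Set.mem_ofPred_eq, not_and_or, not_le, not_le] at hω
        rw [Set.mem_union, Set.mem_ofPred_eq, Set.mem_ofPred_eq, ← hsq]
        rcases hω with h | h
        · left
          calc _ ≤ (2 / 5 * σ * √N) ^ 2 := pow_le_pow_left₀ (vnorm_nonneg _) h.le 2
            _ = _ := by rw [mul_pow, mul_pow, hN]; norm_num
        · right
          calc _ = (9 / 5 * σ * √N) ^ 2 := by rw [mul_pow, mul_pow, hN]; norm_num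
            _ ≤ _ := pow_le_pow_left₀ (by positivity) h.le 2
    _ ≤ _ := measure_union_le _ _
    _ ≤ ENNReal.ofReal (Real.exp (-(9 / 20) * N)) + ENNReal.ofReal (Real.exp (-(9 / 20) * N)) := by
        rw [← ofReal_measureReal, ← ofReal_measureReal]
        gcongr
    _ = _ := by rw [← ENNReal.ofReal_add (by positivity) (by positivity)]; ring_nf

/-- With `N ≥ 8 p K + 16 log (3 K / δ)` trajectories, all singular values of `lastColumns` are at
least `σ √N / 5`, except with probability `δ / 3`. -/
lemma measure_lastColumns (hσ : 0 < σ) {u : Fin N → Fin K → Ω → EuclideanSpace ℝ (Fin p)}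
    (hlaw : ∀ i k, HasLaw (u i k) (multivariateGaussian 0 (σ ^ 2 • (1 : Matrix _ _ ℝ))) P)
    (hind : iIndepFun (fun q : Fin N × Fin K => u q.1 q.2) P) {δ : ℝ} (hδ₀ : 0 < δ)
    (hδ₁ : δ < 1) (hK : 1 ≤ K)
    (hN : 8 * (p : ℝ) * K + 16 * Real.log (3 * K / δ) ≤ N) :
    P {ω | ¬ ∀ x, σ * √N / 5 * vnorm x ≤ vnorm (lastColumns (fun i k => u i k ω) *ᵥ x)}
      ≤ ENNReal.ofReal (δ / 3) := by
  obtain ⟨T, hTc, hT1, hT⟩ := exists_net (Fin K × Fin p)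
  -- Bounds by `9 / 5` and `2 / 5` on the net give the norm bound `10 / 9 * 9 / 5 = 2` and then the
  -- lower bound `2 / 5 - 2 / 10 = 1 / 5` on the sphere.
  rw [Fintype.card_prod, Fintype.card_fin, Fintype.card_fin] at hTc
  have hsub : {ω | ¬ ∀ x, σ * √N / 5 * vnorm x ≤ vnorm (lastColumns (fun i k => u i k ω) *ᵥ x)} ⊆
      ⋃ t ∈ T, {ω | ¬ (2 / 5 * σ * √N ≤ vnorm (lastColumns (fun i k => u i k ω) *ᵥ t) ∧
        vnorm (lastColumns (fun i k => u i k ω) *ᵥ t) ≤ 9 / 5 * σ * √N)} := by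
    intro ω hω
    by_contra hcon
    simp only [Set.mem_iUnion, Set.mem_ofPred_eq, not_exists, not_not] at hcon
    refine hω fun x => ?_
    have hnorm := norm_le_of_net (by positivity) hT fun t ht => (hcon t ht).2
    have h := lower_bound_of_net hT (fun t ht => (hcon t ht).1) hnorm x
    calc _ = (2 / 5 * σ * √N - 10 / 9 * (9 / 5 * σ * √N) / 10) * vnorm x := by ring
      _ ≤ _ := h
  calc _ ≤ _ := measure_mono hsub
    _ ≤ ∑ t ∈ T, P {ω | ¬ (2 / 5 * σ * √N ≤ vnorm (lastColumns (fun i k => u i k ω) *ᵥ t) ∧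
        vnorm (lastColumns (fun i k => u i k ω) *ᵥ t) ≤ 9 / 5 * σ * √N)} :=
      measure_biUnion_finset_le _ _
    _ ≤ ∑ t ∈ T, ENNReal.ofReal (2 * Real.exp (-(9 / 20) * N)) :=
      Finset.sum_le_sum fun t ht => measure_lastColumns_mulVec hσ hlaw hind (hT1 t ht)
    _ = ENNReal.ofReal (T.card * (2 * Real.exp (-(9 / 20) * N))) := by
      rw [Finset.sum_const, nsmul_eq_mul, ENNReal.ofReal_mul (Nat.cast_nonneg _),
        ENNReal.ofReal_natCast]
    _ ≤ ENNReal.ofReal (δ / 3) := by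
      refine ENNReal.ofReal_le_ofReal ?_
      -- `18 / 5 = 8 * 9 / 20` exceeds `log 21`.
      have hTc' : (T.card : ℝ) ≤ Real.exp (18 / 5 * (p * K)) := by
        calc (T.card : ℝ) ≤ (21 : ℝ) ^ (K * p) := by exact_mod_cast hTc
          _ ≤ Real.exp (18 / 5) ^ (K * p) := by
            refine pow_le_pow_left₀ (by norm_num) ?_ _
            refine le_of_pow_le_pow_left₀ (n := 5) (by norm_num) (Real.exp_pos _).le ?_
            rw [← Real.exp_nat_mul]
            have : ((5 : ℕ) : ℝ) * (18 / 5) = (18 : ℕ) * 1 := by norm_num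
            rw [this, Real.exp_nat_mul]
            calc (21 : ℝ) ^ 5 ≤ 2.7 ^ 18 := by norm_num
              _ ≤ _ := pow_le_pow_left₀ (by norm_num) (by linarith [Real.exp_one_gt_d9]) _
          _ = _ := by rw [← Real.exp_nat_mul]; push_cast; ring_nf
      have hK1 : (1 : ℝ) ≤ K := by exact_mod_cast hK
      have h3 : 3 ≤ 3 * K / δ := by
        rw [le_div_iff₀ hδ₀]; nlinarith
      have hlog : 1 ≤ Real.log (3 * K / δ) := by
        rw [Real.le_log_iff_exp_le (by positivity)]
        linarith [Real.exp_one_lt_d9]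
      have hexp : Real.exp (-(9 / 20) * N) ≤
          Real.exp (-(18 / 5 * (p * K))) * (δ / (3 * K)) * Real.exp (-1) := by
        have e1 : δ / (3 * K) = Real.exp (-Real.log (3 * K / δ)) := by
          rw [Real.exp_neg, Real.exp_log (by positivity), inv_div]
        rw [e1, ← Real.exp_add, ← Real.exp_add]
        refine Real.exp_le_exp.2 ?_
        nlinarith
      have he : 2 * Real.exp (-1) ≤ 1 := by
        rw [Real.exp_neg, ← div_eq_mul_inv, div_le_one (Real.exp_pos _)]
        linarith [Real.exp_one_gt_d9]
      have hδK : δ / (3 * K) ≤ δ / 3 := by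
        apply div_le_div_of_nonneg_left hδ₀.le (by norm_num) (by linarith)
      have hcancel : Real.exp (18 / 5 * (p * K)) * Real.exp (-(18 / 5 * (p * K))) = 1 := by
        rw [← Real.exp_add, add_neg_cancel, Real.exp_zero]
      calc _ ≤ Real.exp (18 / 5 * (p * K)) *
            (2 * (Real.exp (-(18 / 5 * (p * K))) * (δ / (3 * K)) * Real.exp (-1))) := by gcongr
        _ = (Real.exp (18 / 5 * (p * K)) * Real.exp (-(18 / 5 * (p * K)))) *
            (2 * Real.exp (-1)) * (δ / (3 * K)) := by ring
        _ ≤ 1 * 1 * (δ / 3) := by rw [hcancel]; gcongr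
        _ = _ := by ring

/-- The smallest singular value of the input matrix is at least that of `lastColumns`. -/
lemma vnorm_lastColumns_le (hK : 0 < K) (u : Fin N → Fin K → EuclideanSpace ℝ (Fin p))
    (x : Fin K × Fin p → ℝ) :
    vnorm (lastColumns u *ᵥ x) ≤ vnorm ((inputMatrix u)ᵀ *ᵥ x) := by
  refine le_of_sq_le_sq ?_ (vnorm_nonneg _)
  rw [vnorm_sq_eq_sum, vnorm_sq_eq_sum, Fintype.sum_prod_type]
  refine Finset.sum_le_sum fun i _ => ?_
  have h : (lastColumns u *ᵥ x) i = ((inputMatrix u)ᵀ *ᵥ x) (i, ⟨K - 1, by omega⟩) := by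
    refine Finset.sum_congr rfl fun la _ => ?_
    congr 1
    have hle : la.1 ≤ (⟨K - 1, by omega⟩ : Fin K) := by
      rw [Fin.le_def]; have := la.1.isLt; simp only; omega
    simp only [lastColumns, inputMatrix, Matrix.of_apply, Matrix.transpose_apply, if_pos hle]
    have hrev : la.1.rev = ⟨K - 1 - (la.1 : ℕ), by omega⟩ := by
      ext
      simp only [Fin.val_rev]
      omega
    rw [hrev]
  rw [h]
  exact Finset.single_le_sum (f := fun k => ‖((inputMatrix u)ᵀ *ᵥ x) (i, k)‖ ^ 2)
    (fun k _ => by positivity) (Finset.mem_univ _)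

end Excitation

/-! ### Least squares -/

section LeastSquares

variable {ι κ τ : Type*} [Fintype ι] [Fintype κ] [Fintype τ]

lemma dotProduct_mul_transpose_mulVec (U : Matrix κ τ ℝ) (x : κ → ℝ) :
    x ⬝ᵥ (U * Uᵀ) *ᵥ x = vnorm (Uᵀ *ᵥ x) ^ 2 := by
  rw [vnorm_sq, ← Matrix.mulVec_mulVec, Matrix.dotProduct_mulVec, Matrix.mulVec_transpose]

variable [DecidableEq κ]

/-- The right inverse `Uᵀ (U Uᵀ)⁻¹` of a matrix `U` of full row rank. -/
noncomputable def rightInv (U : Matrix κ τ ℝ) : Matrix τ κ ℝ := Uᵀ * (U * Uᵀ)⁻¹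

variable {U : Matrix κ τ ℝ} {α : ℝ}

lemma isUnit_det_mul_transpose (hα : 0 < α) (h : ∀ x, α * vnorm x ≤ vnorm (Uᵀ *ᵥ x)) :
    IsUnit (U * Uᵀ).det := by
  rw [← Matrix.isUnit_iff_isUnit_det, ← Matrix.mulVec_injective_iff_isUnit]
  refine (injective_iff_map_eq_zero (Matrix.mulVecLin (U * Uᵀ))).2 fun x hx => ?_
  have h1 := dotProduct_mul_transpose_mulVec U x
  rw [show (U * Uᵀ) *ᵥ x = 0 from hx, dotProduct_zero] at h1
  have h2 : vnorm (Uᵀ *ᵥ x) = 0 := by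
    rwa [eq_comm, sq_eq_zero_iff] at h1
  have h3 := h x
  rw [h2] at h3
  have h4 : vnorm x ≤ 0 := by
    by_contra hc
    exact absurd h3 (not_le.2 (mul_pos hα (not_le.1 hc)))
  exact vnorm_eq_zero.1 (le_antisymm h4 (vnorm_nonneg x))

lemma mul_rightInv (hα : 0 < α) (h : ∀ x, α * vnorm x ≤ vnorm (Uᵀ *ᵥ x)) :
    U * rightInv U = 1 := by
  rw [rightInv, ← Matrix.mul_assoc, Matrix.mul_nonsing_inv _ (isUnit_det_mul_transpose hα h)]

lemma vnorm_rightInv_mulVec_le (hα : 0 < α) (h : ∀ x, α * vnorm x ≤ vnorm (Uᵀ *ᵥ x))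
    (z : κ → ℝ) : vnorm (rightInv U *ᵥ z) ≤ vnorm z / α := by
  set x := (U * Uᵀ)⁻¹ *ᵥ z with hx
  have e : rightInv U *ᵥ z = Uᵀ *ᵥ x := by rw [rightInv, hx, Matrix.mulVec_mulVec]
  have hz : (U * Uᵀ) *ᵥ x = z := by
    rw [hx, Matrix.mulVec_mulVec, Matrix.mul_nonsing_inv _ (isUnit_det_mul_transpose hα h),
      Matrix.one_mulVec]
  have h1 : vnorm (Uᵀ *ᵥ x) ^ 2 ≤ vnorm x * vnorm z := by
    rw [← dotProduct_mul_transpose_mulVec, hz]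
    exact dotProduct_le_vnorm x z
  rw [e, le_div_iff₀ hα]
  have ha := vnorm_nonneg (Uᵀ *ᵥ x)
  rcases ha.eq_or_lt with h0 | h0
  · rw [← h0, zero_mul]; exact vnorm_nonneg z
  · refine le_of_mul_le_mul_left ?_ h0
    calc vnorm (Uᵀ *ᵥ x) * (vnorm (Uᵀ *ᵥ x) * α) = vnorm (Uᵀ *ᵥ x) ^ 2 * α := by ring
      _ ≤ vnorm x * vnorm z * α := by gcongr
      _ = α * vnorm x * vnorm z := by ring
      _ ≤ _ := mul_le_mul_of_nonneg_right (h x) (vnorm_nonneg z)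

/-- If `U` has full row rank then the least squares estimate is `Y Uᵀ (U Uᵀ)⁻¹`; its error is the
noise times the right inverse of `U`. -/
lemma IsLeastSquares.eq_add_mul_rightInv (hα : 0 < α)
    (h : ∀ x, α * vnorm x ≤ vnorm (Uᵀ *ᵥ x)) {Y E : Matrix ι τ ℝ} {G Ghat : Matrix ι κ ℝ}
    (hY : Y = G * U + E) (hls : IsLeastSquares Y U Ghat) : Ghat = G + E * rightInv U := by
  have hR := mul_rightInv hα h
  set X := Y * rightInv U with hX
  have hXeq : X = G + E * rightInv U := by
    rw [hX, hY, Matrix.add_mul, Matrix.mul_assoc, hR, Matrix.mul_one]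
  have horth : (Y - X * U) * Uᵀ = 0 := by
    rw [hX, rightInv, Matrix.sub_mul, Matrix.mul_assoc _ U Uᵀ, ← Matrix.mul_assoc Y,
      Matrix.mul_assoc (Y * Uᵀ), Matrix.nonsing_inv_mul _ (isUnit_det_mul_transpose hα h),
      Matrix.mul_one, sub_self]
  have hcross : ∑ a, ∑ t, (Y - X * U) a t * ((X - Ghat) * U) a t = 0 := by
    have : ((Y - X * U) * ((X - Ghat) * U)ᵀ).trace = 0 := by
      rw [Matrix.transpose_mul, ← Matrix.mul_assoc, horth, Matrix.zero_mul, Matrix.trace_zero]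
    simpa only [Matrix.trace, Matrix.diag_apply, Matrix.mul_apply (M := Y - X * U),
      Matrix.transpose_apply] using this
  have hsplit : ∑ a, ∑ t, (Y - Ghat * U) a t ^ 2
      = ∑ a, ∑ t, (Y - X * U) a t ^ 2 + ∑ a, ∑ t, ((X - Ghat) * U) a t ^ 2 := by
    have e : Y - Ghat * U = (Y - X * U) + (X - Ghat) * U := by
      rw [Matrix.sub_mul]; abel
    have e' : ∀ a t, (Y - Ghat * U) a t ^ 2 = (Y - X * U) a t ^ 2 + ((X - Ghat) * U) a t ^ 2
        + 2 * ((Y - X * U) a t * ((X - Ghat) * U) a t) := fun a t => by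
      rw [e, Matrix.add_apply]; ring
    simp_rw [e', Finset.sum_add_distrib, ← Finset.mul_sum, hcross]
    ring
  have hzero : ∑ a, ∑ t, ((X - Ghat) * U) a t ^ 2 = 0 := by
    refine le_antisymm ?_ (by positivity)
    have := hls X
    linarith
  have hXU : (X - Ghat) * U = 0 := by
    ext a t
    rw [Finset.sum_eq_zero_iff_of_nonneg (fun _ _ => by positivity)] at hzero
    have h2 := hzero a (Finset.mem_univ a)
    rw [Finset.sum_eq_zero_iff_of_nonneg (fun _ _ => by positivity)] at h2
    exact pow_eq_zero_iff two_ne_zero |>.1 (h2 t (Finset.mem_univ t))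
  have : X - Ghat = 0 := by
    calc X - Ghat = (X - Ghat) * (U * rightInv U) := by rw [hR, Matrix.mul_one]
      _ = 0 := by rw [← Matrix.mul_assoc, hXU, Matrix.zero_mul]
  rw [← hXeq, sub_eq_zero.1 this]

lemma measurable_det {𝓤 : Type*} [MeasurableSpace 𝓤] {M : 𝓤 → Matrix κ κ ℝ}
    (hM : ∀ i j, Measurable fun y => M y i j) : Measurable fun y => (M y).det := by
  simp_rw [Matrix.det_apply]
  exact Finset.measurable_sum _ fun σ _ =>
    (Finset.measurable_prod _ fun i _ => hM _ _).const_smul _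

lemma measurable_rightInv_mulVec {𝓤 : Type*} [MeasurableSpace 𝓤] {M : 𝓤 → Matrix κ τ ℝ}
    (hM : ∀ i j, Measurable fun y => M y i j) (t : κ → ℝ) (q : τ) :
    Measurable fun y => (rightInv (M y) *ᵥ t) q := by
  have hMM : ∀ i j, Measurable fun y => (M y * (M y)ᵀ) i j := fun i j => by
    simp_rw [Matrix.mul_apply, Matrix.transpose_apply]
    exact Finset.measurable_sum _ fun r _ => (hM i r).mul (hM j r)
  have hinv : ∀ i j, Measurable fun y => (M y * (M y)ᵀ)⁻¹ i j := fun i j => by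
    simp_rw [Matrix.inv_def, Ring.inverse_eq_inv', Matrix.smul_apply, Matrix.adjugate_apply,
      smul_eq_mul]
    refine (measurable_det hMM).inv.mul (measurable_det fun a b => ?_)
    simp_rw [Matrix.updateRow_apply]
    split_ifs
    · exact measurable_const
    · exact hMM a b
  simp_rw [Matrix.mulVec, dotProduct, rightInv, Matrix.mul_apply, Matrix.transpose_apply]
  exact Finset.measurable_sum _ fun b _ =>
    (Finset.measurable_sum _ fun r _ => (hM r q).mul (hinv r b)).mul_const _

end LeastSquares

/-! ### The trajectories -/

section Trajectories

variable {n m p N K : ℕ}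

lemma sum_ite_add_eq {M : Type*} [AddCommMonoid M] (l k : Fin K) (f : Fin K → M) :
    ∑ j : Fin K, (if (l : ℕ) + j = k then f j else 0) =
      if l ≤ k then f ⟨(k : ℕ) - (l : ℕ), lt_of_le_of_lt (Nat.sub_le _ _) k.isLt⟩ else 0 := by
  split_ifs with hlk
  · rw [Finset.sum_eq_single ⟨(k : ℕ) - (l : ℕ), lt_of_le_of_lt (Nat.sub_le _ _) k.isLt⟩]
    · rw [if_pos]
      simp only
      have : (l : ℕ) ≤ k := hlk
      omega
    · intro j _ hj
      rw [if_neg]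
      intro h
      exact hj (Fin.ext (by simp only; omega))
    · simp
  · refine Finset.sum_eq_zero fun j _ => if_neg fun h => hlk ?_
    rw [Fin.le_def]
    omega

/-- The block row `[M 0, M 1, …, M (K-1)]`. -/
def blockRow (K : ℕ) (M : ℕ → Matrix (Fin m) (Fin p) ℝ) : Matrix (Fin m) (Fin K × Fin p) ℝ :=
  Matrix.of fun a kb => M kb.1 a kb.2

/-- Multiplication by the Toeplitz matrix of the inputs is a convolution. -/
lemma blockRow_mul_inputMatrix (M : ℕ → Matrix (Fin m) (Fin p) ℝ)
    (u : Fin N → Fin K → EuclideanSpace ℝ (Fin p)) (z : ℕ → Fin p → ℝ) (i : Fin N) (k : Fin K)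
    (hz : ∀ j : Fin K, z j = (u i j).ofLp) (a : Fin m) :
    (blockRow K M * inputMatrix u) a (i, k)
      = (∑ l ∈ Finset.range (k + 1), M l *ᵥ z (k - l)) a := by
  have h1 : (blockRow K M * inputMatrix u) a (i, k)
      = ∑ l : Fin K, if (l : ℕ) ≤ k then (M l *ᵥ z (k - l)) a else 0 := by
    rw [Matrix.mul_apply, Fintype.sum_prod_type]
    refine Finset.sum_congr rfl fun l _ => ?_
    by_cases hlk : l ≤ k
    · rw [if_pos (Fin.le_def.1 hlk), Matrix.mulVec, dotProduct]
      have := hz ⟨(k : ℕ) - (l : ℕ), lt_of_le_of_lt (Nat.sub_le _ _) k.isLt⟩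
      simp only at this
      rw [this]
      refine Finset.sum_congr rfl fun b _ => ?_
      simp [blockRow, inputMatrix, hlk]
    · rw [if_neg (fun h => hlk (Fin.le_def.2 h))]
      refine Finset.sum_eq_zero fun b _ => ?_
      simp [inputMatrix, hlk]
  rw [h1, Fin.sum_univ_eq_sum_range (fun l => if l ≤ (k : ℕ) then (M l *ᵥ z (k - l)) a else 0) K,
    Finset.sum_apply, ← Finset.sum_filter]
  refine Finset.sum_congr ?_ fun _ _ => rfl
  ext l
  have := k.isLt
  simp only [Finset.mem_filter, Finset.mem_range]
  omega

lemma markov_eq_blockRow (A : Matrix (Fin n) (Fin n) ℝ) (B : Matrix (Fin n) (Fin p) ℝ)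
    (C : Matrix (Fin m) (Fin n) ℝ) (D : Matrix (Fin m) (Fin p) ℝ) :
    markov K A B C D = blockRow K fun l => if l = 0 then D else C * A ^ (l - 1) * B := by
  ext a kb
  simp only [markov, blockRow, Matrix.of_apply]
  split_ifs <;> rfl

lemma noiseMarkov_eq_blockRow (A : Matrix (Fin n) (Fin n) ℝ) (C : Matrix (Fin m) (Fin n) ℝ) :
    noiseMarkov K A C = blockRow K fun l => if l = 0 then 0 else C * A ^ (l - 1) := by
  ext a kb
  simp only [noiseMarkov, blockRow, Matrix.of_apply]
  split_ifs <;> rfl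

lemma state_eq_sum {A : Matrix (Fin n) (Fin n) ℝ} {x e : ℕ → Fin n → ℝ} (h0 : x 0 = 0)
    (hx : ∀ k < K, x (k + 1) = A *ᵥ x k + e k) :
    ∀ k ≤ K, x k = ∑ l ∈ Finset.range k, A ^ l *ᵥ e (k - (l + 1)) := by
  intro k
  induction k with
  | zero => intro _; simp [h0]
  | succ k ih =>
    intro hk
    rw [hx k (by omega), ih (by omega), Finset.sum_range_succ', Matrix.mulVec_sum]
    congr 1
    · refine Finset.sum_congr rfl fun l _ => ?_
      rw [Matrix.mulVec_mulVec, pow_succ', Nat.add_sub_add_right]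
    · simp

/-- The outputs are linear in the inputs and the noises, with coefficients the Markov
parameters. -/
lemma IsExperiment.outputMatrix_eq {Ω : Type*} [MeasurableSpace Ω] {P : Measure Ω}
    {A : Matrix (Fin n) (Fin n) ℝ} {B : Matrix (Fin n) (Fin p) ℝ}
    {C : Matrix (Fin m) (Fin n) ℝ} {D : Matrix (Fin m) (Fin p) ℝ} {σu σw σv : ℝ}
    {u : Fin N → Fin K → Ω → EuclideanSpace ℝ (Fin p)}
    {w : Fin N → Fin K → Ω → EuclideanSpace ℝ (Fin n)}
    {v : Fin N → Fin K → Ω → EuclideanSpace ℝ (Fin m)}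
    {x : Fin N → Fin (K + 1) → Ω → (Fin n → ℝ)} {y : Fin N → Fin K → Ω → (Fin m → ℝ)}
    (h : IsExperiment P A B C D σu σw σv u w v x y) (ω : Ω) :
    outputMatrix (fun i k => y i k ω)
      = markov K A B C D * inputMatrix (fun i k => u i k ω)
        + (noiseMarkov K A C * inputMatrix (fun i k => w i k ω)
          + outputMatrix fun i k => (v i k ω).ofLp) := by
  ext a ⟨i, k⟩
  let zu : ℕ → Fin p → ℝ := fun j => if hj : j < K then (u i ⟨j, hj⟩ ω).ofLp else 0
  let zw : ℕ → Fin n → ℝ := fun j => if hj : j < K then (w i ⟨j, hj⟩ ω).ofLp else 0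
  let xs : ℕ → Fin n → ℝ := fun j => if hj : j < K + 1 then x i ⟨j, hj⟩ ω else 0
  have hzu : ∀ j : Fin K, zu j = (u i j ω).ofLp := fun j => by simp [zu]
  have hzw : ∀ j : Fin K, zw j = (w i j ω).ofLp := fun j => by simp [zw]
  have hxs : ∀ j : Fin (K + 1), xs j = x i j ω := fun j => by
    simp only [xs, dif_pos j.isLt]
  have hstate := state_eq_sum (K := K) (A := A) (x := xs) (e := fun j => B *ᵥ zu j + zw j)
    ((hxs 0).trans (h.init i ω)) (fun j hj => by
      have := h.state_eq i ⟨j, hj⟩ ω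
      rw [← hxs, ← hxs, ← hzu, ← hzw] at this
      simpa [add_assoc] using this) k k.isLt.le
  have hout := congrFun (h.output_eq i k ω) a
  rw [← hxs, ← hzu] at hout
  rw [Matrix.add_apply, Matrix.add_apply, markov_eq_blockRow, noiseMarkov_eq_blockRow,
    blockRow_mul_inputMatrix _ _ zu i k hzu, blockRow_mul_inputMatrix _ _ zw i k hzw,
    Finset.sum_range_succ', Finset.sum_range_succ']
  simp only [outputMatrix, Matrix.of_apply]
  rw [hout]
  simp only [Fin.val_castSucc, Nat.add_eq_zero_iff, one_ne_zero, and_false, if_false, if_true,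
    Nat.add_sub_cancel, Nat.sub_zero, Matrix.zero_mulVec, add_zero]
  rw [hstate, Matrix.mulVec_sum]
  simp only [Matrix.mulVec_add, Matrix.mulVec_mulVec, Finset.sum_add_distrib, Pi.add_apply,
    ← Matrix.mul_assoc]
  ring

end Trajectories

/-! ### The noise as a linear form -/

section Noise

variable {N K d : ℕ}

/-- The coefficients of `v ↦ s ⬝ V h`, where `V` has columns `v`. -/
noncomputable def outputCoeff (s : Fin d → ℝ) (h : Fin N × Fin K → ℝ) (q : Fin N × Fin K) :
    EuclideanSpace ℝ (Fin d) := h q • WithLp.toLp 2 s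

lemma dotProduct_outputMatrix_mulVec (s : Fin d → ℝ) (h : Fin N × Fin K → ℝ)
    (z : Fin N × Fin K → EuclideanSpace ℝ (Fin d)) :
    s ⬝ᵥ outputMatrix (fun i k => (z (i, k)).ofLp) *ᵥ h = linForm (outputCoeff s h) z := by
  rw [Matrix.dotProduct_mulVec, linForm]
  refine Finset.sum_congr rfl fun q _ => ?_
  rw [outputCoeff, real_inner_smul_left, mul_comm]
  congr 1
  simp [outputMatrix, Matrix.vecMul, dotProduct, PiLp.inner_apply, mul_comm]

lemma sum_norm_outputCoeff (s : Fin d → ℝ) (h : Fin N × Fin K → ℝ) :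
    ∑ q, ‖outputCoeff s h q‖ ^ 2 = vnorm h ^ 2 * vnorm s ^ 2 := by
  simp_rw [outputCoeff, norm_smul, mul_pow, ← Finset.sum_mul, vnorm_sq_eq_sum h]
  rfl

/-- The coefficients of `w ↦ s ⬝ W h`, where `W` is the block Toeplitz matrix of `w`. -/
noncomputable def inputCoeff (s : Fin K × Fin d → ℝ) (h : Fin N × Fin K → ℝ)
    (q : Fin N × Fin K) : EuclideanSpace ℝ (Fin d) :=
  ∑ l : Fin K, (∑ k : Fin K, if (l : ℕ) + q.2 = k then h (q.1, k) else 0) •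
    WithLp.toLp 2 fun b => s (l, b)

lemma dotProduct_inputMatrix_mulVec (s : Fin K × Fin d → ℝ) (h : Fin N × Fin K → ℝ)
    (z : Fin N × Fin K → EuclideanSpace ℝ (Fin d)) :
    s ⬝ᵥ inputMatrix (fun i k => z (i, k)) *ᵥ h = linForm (inputCoeff s h) z := by
  have e : ∀ l b i k, inputMatrix (fun i k => z (i, k)) (l, b) (i, k)
      = ∑ j : Fin K, if (l : ℕ) + j = k then z (i, j) b else 0 := fun l b i k => by
    rw [sum_ite_add_eq l k fun j => z (i, j) b]; rfl
  let f : Fin K → Fin d → Fin N → Fin K → Fin K → ℝ := fun l b i k j =>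
    if (l : ℕ) + j = k then s (l, b) * z (i, j) b * h (i, k) else 0
  have hl : s ⬝ᵥ inputMatrix (fun i k => z (i, k)) *ᵥ h = ∑ l, ∑ b, ∑ i, ∑ k, ∑ j, f l b i k j := by
    simp only [dotProduct, Matrix.mulVec, Fintype.sum_prod_type, e, Finset.mul_sum, Finset.sum_mul,
      ite_mul, mul_ite, zero_mul, mul_zero, mul_assoc, f]
  have hr : linForm (inputCoeff s h) z = ∑ i, ∑ j, ∑ l, ∑ k, ∑ b, f l b i k j := by
    rw [linForm, Fintype.sum_prod_type]
    refine Finset.sum_congr rfl fun i _ => Finset.sum_congr rfl fun j _ => ?_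
    rw [inputCoeff, sum_inner]
    refine Finset.sum_congr rfl fun l _ => ?_
    rw [real_inner_smul_left, Finset.sum_mul]
    refine Finset.sum_congr rfl fun k _ => ?_
    rw [PiLp.inner_apply, Finset.mul_sum]
    refine Finset.sum_congr rfl fun b _ => ?_
    simp only [f, ite_mul, zero_mul]
    split_ifs
    · simp only [RCLike.inner_apply, conj_trivial]; ring
    · rfl
  rw [hl, hr]
  calc _ = ∑ l, ∑ i, ∑ b, ∑ k, ∑ j, f l b i k j :=
        Finset.sum_congr rfl fun l _ => Finset.sum_comm
    _ = ∑ i, ∑ l, ∑ b, ∑ k, ∑ j, f l b i k j := Finset.sum_comm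
    _ = ∑ i, ∑ l, ∑ k, ∑ b, ∑ j, f l b i k j :=
        Finset.sum_congr rfl fun i _ => Finset.sum_congr rfl fun l _ => Finset.sum_comm
    _ = ∑ i, ∑ l, ∑ k, ∑ j, ∑ b, f l b i k j :=
        Finset.sum_congr rfl fun i _ => Finset.sum_congr rfl fun l _ =>
          Finset.sum_congr rfl fun k _ => Finset.sum_comm
    _ = ∑ i, ∑ l, ∑ j, ∑ k, ∑ b, f l b i k j :=
        Finset.sum_congr rfl fun i _ => Finset.sum_congr rfl fun l _ => Finset.sum_comm
    _ = _ := Finset.sum_congr rfl fun i _ => Finset.sum_comm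

lemma sum_norm_inputCoeff_le (s : Fin K × Fin d → ℝ) (h : Fin N × Fin K → ℝ) :
    ∑ q, ‖inputCoeff s h q‖ ^ 2 ≤ K * (vnorm h ^ 2 * vnorm s ^ 2) := by
  let S : Fin K → EuclideanSpace ℝ (Fin d) := fun l => WithLp.toLp 2 fun b => s (l, b)
  have hS : ∑ l, ‖S l‖ ^ 2 = vnorm s ^ 2 := by
    simp [S, vnorm_sq_eq_sum, EuclideanSpace.norm_sq_eq, Fintype.sum_prod_type]
  have hq : ∀ q, ‖inputCoeff s h q‖ ^ 2 ≤
      (∑ l : Fin K, ∑ k : Fin K, if (l : ℕ) + q.2 = k then h (q.1, k) ^ 2 else 0) *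
        vnorm s ^ 2 := fun q => by
    have hsq : ∀ l : Fin K, (∑ k : Fin K, if (l : ℕ) + q.2 = k then h (q.1, k) else 0) ^ 2
        = ∑ k : Fin K, if (l : ℕ) + q.2 = k then h (q.1, k) ^ 2 else 0 := fun l => by
      by_cases hlt : (l : ℕ) + q.2 < K
      · have e : ∀ k : Fin K, (l : ℕ) + q.2 = k ↔ ⟨(l : ℕ) + q.2, hlt⟩ = k := fun k => by
          rw [Fin.ext_iff]
        simp [e]
      · have e : ∀ k : Fin K, ¬ (l : ℕ) + q.2 = k := fun k => by have := k.isLt; omega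
        simp [e]
    calc ‖inputCoeff s h q‖ ^ 2
        ≤ (∑ l : Fin K, |∑ k : Fin K, if (l : ℕ) + q.2 = k then h (q.1, k) else 0| *
            ‖S l‖) ^ 2 := by
          refine pow_le_pow_left₀ (norm_nonneg _) ((norm_sum_le _ _).trans_eq ?_) 2
          simp_rw [norm_smul, Real.norm_eq_abs]
          rfl
      _ ≤ (∑ l : Fin K, |∑ k : Fin K, if (l : ℕ) + q.2 = k then h (q.1, k) else 0| ^ 2) *
          ∑ l, ‖S l‖ ^ 2 := Finset.sum_mul_sq_le_sq_mul_sq _ _ _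
      _ = _ := by simp_rw [sq_abs, hsq, hS]
  calc _ ≤ ∑ q : Fin N × Fin K, (∑ l : Fin K, ∑ k : Fin K,
          if (l : ℕ) + q.2 = k then h (q.1, k) ^ 2 else 0) * vnorm s ^ 2 :=
        Finset.sum_le_sum fun q _ => hq q
    _ = (∑ i : Fin N, ∑ l : Fin K, ∑ k : Fin K, ∑ j : Fin K,
          if (l : ℕ) + j = k then h (i, k) ^ 2 else 0) * vnorm s ^ 2 := by
        rw [← Finset.sum_mul, Fintype.sum_prod_type]
        congr 1
        refine Finset.sum_congr rfl fun i _ => ?_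
        rw [Finset.sum_comm]
        exact Finset.sum_congr rfl fun l _ => Finset.sum_comm
    _ ≤ (∑ i : Fin N, ∑ _l : Fin K, ∑ k : Fin K, h (i, k) ^ 2) * vnorm s ^ 2 := by
        gcongr with i _ l _ k _
        rw [sum_ite_add_eq l k fun _ => h (i, k) ^ 2]
        split_ifs
        · exact le_rfl
        · positivity
    _ = _ := by
        rw [vnorm_sq_eq_sum h, Fintype.sum_prod_type]
        simp [← Finset.mul_sum]
        ring

end Noise

/-! ### Estimation of the Markov parameters -/

section Estimation

variable {Ω : Type*} [MeasurableSpace Ω] {P : Measure Ω}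

/-- A random matrix `X (Y, ξ)` whose bilinear forms are, given `Y`, linear in the Gaussian
family `ξ` with variance at most `v` on the event `good`. The hypothesis on `τ`
makes the union bound over two nets at most `ε`. -/
lemma measure_norm_gt_le {Q ι κ 𝓤 : Type*} [Fintype Q] [Fintype ι] [Fintype κ] [DecidableEq κ]
    [MeasurableSpace 𝓤] {d : ℕ} {σ : ℝ} {ξ : Q → Ω → EuclideanSpace ℝ (Fin d)}
    (hlaw : ∀ q, HasLaw (ξ q) (multivariateGaussian 0 (σ ^ 2 • (1 : Matrix _ _ ℝ))) P)
    (hind : iIndepFun ξ P) {Y : Ω → 𝓤} (hY : AEMeasurable Y P)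
    (hYξ : IndepFun Y (fun ω q => ξ q ω) P) {X : Ω → Matrix ι κ ℝ} {good : Ω → Prop}
    {c : (ι → ℝ) → (κ → ℝ) → 𝓤 → Q → EuclideanSpace ℝ (Fin d)}
    (hc : ∀ s t q, Measurable fun y => c s t y q)
    (hX : ∀ s t ω, s ⬝ᵥ X ω *ᵥ t = linForm (c s t (Y ω)) fun q => ξ q ω)
    {v τ ε : ℝ} (hv : ∀ s t, vnorm s = 1 → vnorm t = 1 → ∀ ω, good ω →
      σ ^ 2 * ∑ q, ‖c s t (Y ω) q‖ ^ 2 ≤ v) (hτ : 0 ≤ τ) (hε : 0 < ε)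
    (hτv : 61 / 20 * ((Fintype.card ι : ℝ) + Fintype.card κ) - Real.log ε ≤ τ ^ 2 / (2 * v)) :
    P {ω | good ω ∧ ¬ ‖X ω‖ ≤ 5 / 4 * τ} ≤ ENNReal.ofReal ε := by
  obtain ⟨S, hSc, hS1, hS⟩ := exists_net ι
  obtain ⟨T, hTc, hT1, hT⟩ := exists_net κ
  let bad : (ι → ℝ) × (κ → ℝ) → Set Ω := fun st =>
    {ω | σ ^ 2 * ∑ q, ‖c st.1 st.2 (Y ω) q‖ ^ 2 ≤ v ∧
      τ ≤ linForm (c st.1 st.2 (Y ω)) fun q => ξ q ω}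
  have hsub : {ω | good ω ∧ ¬ ‖X ω‖ ≤ 5 / 4 * τ} ⊆ ⋃ st ∈ S ×ˢ T, bad st := by
    rintro ω ⟨hg, hω⟩
    by_contra hcon
    refine hω (norm_le_of_nets hτ hS hT1 hT fun s hs t ht => ?_)
    by_contra hlt
    refine hcon (Set.mem_iUnion₂.2 ⟨(s, t), Finset.mem_product.2 ⟨hs, ht⟩,
      hv s t (hS1 s hs) (hT1 t ht) ω hg, ?_⟩)
    rw [← hX]
    exact (not_le.1 hlt).le
  -- `61 / 20` is slightly larger than `log 21`.
  have h21 : ∀ k : ℕ, (21 : ℝ) ^ k ≤ Real.exp (61 / 20 * k) := fun k => by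
    rw [mul_comm, Real.exp_nat_mul]
    refine pow_le_pow_left₀ (by norm_num) ?_ _
    refine le_of_pow_le_pow_left₀ (n := 20) (by norm_num) (Real.exp_pos _).le ?_
    rw [← Real.exp_nat_mul]
    have : ((20 : ℕ) : ℝ) * (61 / 20) = (61 : ℕ) * 1 := by norm_num
    rw [this, Real.exp_nat_mul]
    calc (21 : ℝ) ^ 20 ≤ 2.718 ^ 61 := by norm_num
      _ ≤ _ := pow_le_pow_left₀ (by norm_num) (by linarith [Real.exp_one_gt_d9]) _
  calc _ ≤ _ := measure_mono hsub
    _ ≤ ∑ st ∈ S ×ˢ T, P (bad st) := measure_biUnion_finset_le _ _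
    _ ≤ ∑ st ∈ S ×ˢ T, ENNReal.ofReal (Real.exp (-τ ^ 2 / (2 * v))) :=
      Finset.sum_le_sum fun st _ =>
        measure_linForm_ge_le_of_indep hlaw hind hY hYξ (hc st.1 st.2) hτ
    _ = ENNReal.ofReal ((S.card * T.card : ℕ) * Real.exp (-τ ^ 2 / (2 * v))) := by
      rw [Finset.sum_const, Finset.card_product, nsmul_eq_mul,
        ENNReal.ofReal_mul (Nat.cast_nonneg _), ENNReal.ofReal_natCast]
    _ ≤ ENNReal.ofReal ε := by
      refine ENNReal.ofReal_le_ofReal ?_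
      have hcard : ((S.card * T.card : ℕ) : ℝ) ≤
          Real.exp (61 / 20 * ((Fintype.card ι : ℝ) + Fintype.card κ)) := by
        rw [mul_add, Real.exp_add, Nat.cast_mul]
        refine mul_le_mul (le_trans ?_ (h21 _)) (le_trans ?_ (h21 _)) (Nat.cast_nonneg _)
          (Real.exp_pos _).le
        · exact_mod_cast hSc
        · exact_mod_cast hTc
      calc _ ≤ Real.exp (61 / 20 * ((Fintype.card ι : ℝ) + Fintype.card κ)) *
            Real.exp (-τ ^ 2 / (2 * v)) := by gcongr
        _ = Real.exp (61 / 20 * ((Fintype.card ι : ℝ) + Fintype.card κ) - τ ^ 2 / (2 * v)) := by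
            rw [← Real.exp_add, neg_div, sub_eq_add_neg]
        _ ≤ Real.exp (Real.log ε) := Real.exp_le_exp.2 (by linarith)
        _ = ε := Real.exp_log hε

variable {n m p N K : ℕ} {A : Matrix (Fin n) (Fin n) ℝ} {B : Matrix (Fin n) (Fin p) ℝ}
  {C : Matrix (Fin m) (Fin n) ℝ} {D : Matrix (Fin m) (Fin p) ℝ} {σu σw σv δ : ℝ}
  {u : Fin N → Fin K → Ω → EuclideanSpace ℝ (Fin p)}
  {w : Fin N → Fin K → Ω → EuclideanSpace ℝ (Fin n)}
  {v : Fin N → Fin K → Ω → EuclideanSpace ℝ (Fin m)}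
  {x : Fin N → Fin (K + 1) → Ω → (Fin n → ℝ)} {y : Fin N → Fin K → Ω → (Fin m → ℝ)}

lemma measurable_inputMatrix (a : Fin K × Fin p) (b : Fin N × Fin K) :
    Measurable fun z : Fin N × Fin K → EuclideanSpace ℝ (Fin p) =>
      inputMatrix (fun i k => z (i, k)) a b := by
  simp only [inputMatrix, Matrix.of_apply]
  split_ifs
  · fun_prop
  · exact measurable_const

lemma measurable_outputCoeff {𝓤 : Type*} [MeasurableSpace 𝓤] {d : ℕ} (s : Fin d → ℝ)
    {h : 𝓤 → Fin N × Fin K → ℝ} (hh : ∀ q, Measurable fun y => h y q) (q : Fin N × Fin K) :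
    Measurable fun y => outputCoeff s (h y) q :=
  (hh q).smul_const _

lemma measurable_inputCoeff {𝓤 : Type*} [MeasurableSpace 𝓤] {d : ℕ} (s : Fin K × Fin d → ℝ)
    {h : 𝓤 → Fin N × Fin K → ℝ} (hh : ∀ q, Measurable fun y => h y q) (q : Fin N × Fin K) :
    Measurable fun y => inputCoeff s (h y) q := by
  unfold inputCoeff
  refine Finset.measurable_sum _ fun l _ => (Finset.measurable_sum _ fun k _ => ?_).smul_const _
  split_ifs
  · exact hh _
  · exact measurable_const

/-- The logarithm of `27 K / δ` exceeds `4` because `27 * 3 > e ^ 4`. -/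
lemma four_le_log (hK : 3 ≤ K) (hδ₀ : 0 < δ) (hδ₁ : δ < 1) : 4 ≤ Real.log (27 * K / δ) := by
  have hK' : (3 : ℝ) ≤ K := by exact_mod_cast hK
  have h81 : 81 ≤ 27 * K / δ := by rw [le_div_iff₀ hδ₀]; nlinarith
  rw [Real.le_log_iff_exp_le (by linarith)]
  have : (4 : ℝ) = (4 : ℕ) * 1 := by norm_num
  rw [this, Real.exp_nat_mul]
  calc Real.exp 1 ^ 4 ≤ 2.72 ^ 4 :=
        pow_le_pow_left₀ (Real.exp_pos _).le (by linarith [Real.exp_one_lt_d9]) _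
    _ ≤ _ := by norm_num; linarith

lemma neg_log_le (hK : 3 ≤ K) (hδ₀ : 0 < δ) : -Real.log (δ / 3) ≤ Real.log (27 * K / δ) := by
  have hK' : (3 : ℝ) ≤ K := by exact_mod_cast hK
  rw [← Real.log_inv, inv_div]
  refine Real.log_le_log (by positivity) ?_
  gcongr
  linarith

/-- With probability `1 - δ`, the least squares error of the Markov parameters is at most
`markovError`, even after multiplication by `√K`. -/
lemma IsExperiment.measure_estimation [IsProbabilityMeasure P]
    (h : IsExperiment P A B C D σu σw σv u w v x y) (hσu : 0 < σu) (hσw : 0 < σw) (hσv : 0 < σv)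
    (hδ₀ : 0 < δ) (hδ₁ : δ < 1) (hp : 1 ≤ p) (hK : 3 ≤ K)
    (hN : 8 * (p : ℝ) * K + 16 * Real.log (3 * K / δ) ≤ N) :
    P {ω | ¬ ∀ Ghat, IsLeastSquares (outputMatrix fun i k => y i k ω)
        (inputMatrix fun i k => u i k ω) Ghat →
        √K * ‖Ghat - markov K A B C D‖ ≤ markovError p K N A C σu σw σv δ} ≤ ENNReal.ofReal δ := by
  have hKr : (3 : ℝ) ≤ K := by exact_mod_cast hK
  have hpr : (1 : ℝ) ≤ p := by exact_mod_cast hp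
  set Λ := Real.log (27 * K / δ) with hΛ
  have hΛ4 : 4 ≤ Λ := four_le_log hK hδ₀ hδ₁
  have hlogδ := neg_log_le hK hδ₀
  rw [← hΛ] at hlogδ
  -- Union bound against the available exponent; `p + r` times `K` bounds the dimension of the nets
  -- both for `r = m` and for `r = n`.
  have hcmp : ∀ r : ℕ, 61 / 20 * (K * ((p : ℝ) + r)) - Real.log (δ / 3) ≤
      8 / 5 * (K * ((p : ℝ) + r) * Λ) := fun r => by
    have hr : (0 : ℝ) ≤ r := Nat.cast_nonneg r
    have ha : 3 ≤ K * ((p : ℝ) + r) := by nlinarith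
    nlinarith
  have hNpos : (0 : ℝ) < N := by
    have : 0 ≤ Real.log (3 * K / δ) := Real.log_nonneg (by rw [le_div_iff₀ hδ₀]; linarith)
    nlinarith
  have hsN : √(N : ℝ) ^ 2 = N := Real.sq_sqrt hNpos.le
  have hsNpos : 0 < √(N : ℝ) := Real.sqrt_pos.2 hNpos
  have hsK : √(K : ℝ) ^ 2 = K := Real.sq_sqrt (by linarith)
  have hsKpos : 0 < √(K : ℝ) := Real.sqrt_pos.2 (by linarith)
  set α := σu * √N / 5 with hα
  have hαpos : 0 < α := by positivity
  have hα2 : α ^ 2 = σu ^ 2 * N / 25 := by rw [hα, div_pow, mul_pow, hsN]; norm_num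
  let Y : Ω → Fin N × Fin K → EuclideanSpace ℝ (Fin p) := fun ω q => u q.1 q.2 ω
  have hY : AEMeasurable Y P := aemeasurable_pi_lambda _ fun q => (h.input_law q.1 q.2).aemeasurable
  let R : (Fin N × Fin K → EuclideanSpace ℝ (Fin p)) → Matrix (Fin N × Fin K) (Fin K × Fin p) ℝ :=
    fun z => rightInv (inputMatrix fun i k => z (i, k))
  have hRmeas : ∀ t q, Measurable fun z => (R z *ᵥ t) q :=
    measurable_rightInv_mulVec measurable_inputMatrix
  let good : Ω → Prop := fun ω => ∀ t, α * vnorm t ≤ vnorm ((inputMatrix fun i k => u i k ω)ᵀ *ᵥ t)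
  have hRle : ∀ ω, good ω → ∀ t, vnorm t = 1 → vnorm (R (Y ω) *ᵥ t) ^ 2 ≤ 25 / (σu ^ 2 * N) :=
    fun ω hg t ht => by
      have := vnorm_rightInv_mulVec_le hαpos hg t
      rw [ht] at this
      calc _ ≤ (1 / α) ^ 2 := pow_le_pow_left₀ (vnorm_nonneg _) this 2
        _ = _ := by rw [div_pow, hα2]; field_simp
  -- Sufficient excitation: all singular values of `U` are at least `α`.
  have hexc : P {ω | ¬ good ω} ≤ ENNReal.ofReal (δ / 3) := by
    refine (measure_mono fun ω hω => ?_).trans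
      (measure_lastColumns hσu h.input_law h.input_indep hδ₀ hδ₁ (by omega) hN)
    exact fun hcon => hω fun t => (hcon t).trans (vnorm_lastColumns_le (by omega) _ t)
  -- The measurement noise. The factor `4 / 5` cancels the loss `5 / 4` of the two nets.
  set c₁ := constOne m p K δ with hc₁
  have hc₁0 : 0 ≤ c₁ := by rw [hc₁, constOne]; positivity
  have hc₁2 : c₁ ^ 2 = 64 * (2 * K * (K + 1) * (p + m) * Λ) := by
    rw [hc₁, constOne, mul_pow, Real.sq_sqrt (by positivity), ← hΛ]; norm_num
  set τ₁ := 4 / 5 * (σv * c₁ / (σu * √N * √K)) with hτ₁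
  have hV := measure_norm_gt_le (P := P) (fun q : Fin N × Fin K => h.meas_law q.1 q.2)
    h.meas_indep hY (h.input_noise_indep.comp measurable_id measurable_snd)
    (X := fun ω => (outputMatrix fun i k => (v i k ω).ofLp) * R (Y ω)) (good := good)
    (c := fun s t z => outputCoeff s (R z *ᵥ t))
    (fun s t q => measurable_outputCoeff s (hRmeas t) q)
    (fun s t ω => by
      rw [← Matrix.mulVec_mulVec]
      exact dotProduct_outputMatrix_mulVec s _ fun q => v q.1 q.2 ω)
    (v := 25 * σv ^ 2 / (σu ^ 2 * N)) (τ := τ₁) (ε := δ / 3)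
    (fun s t hs ht ω hg => by
      rw [sum_norm_outputCoeff, hs]
      calc _ = σv ^ 2 * vnorm (R (Y ω) *ᵥ t) ^ 2 := by ring
        _ ≤ σv ^ 2 * (25 / (σu ^ 2 * N)) := by gcongr; exact hRle ω hg t ht
        _ = _ := by ring)
    (by positivity) (by positivity) (by
      have e : τ₁ ^ 2 / (2 * (25 * σv ^ 2 / (σu ^ 2 * N)))
          = 1024 / 625 * ((K + 1) * (p + m) * Λ) := by
        simp only [hτ₁, mul_pow, div_pow, hsN, hsK, hc₁2]
        field_simp
        norm_num
      rw [e]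
      simp only [Fintype.card_prod, Fintype.card_fin, Nat.cast_mul]
      have h0 : 0 ≤ ((p : ℝ) + m) * Λ := by positivity
      have h1 : 0 ≤ K * ((p : ℝ) + m) * Λ := by positivity
      have h2 : (m : ℝ) ≤ K * m := le_mul_of_one_le_left (Nat.cast_nonneg m) (by linarith)
      linarith [hcmp m])
  -- The process noise. Bounding `W U†` instead of `F W U†` brings in the norm of `F` as a factor.
  set c₂ := constTwo n p K 1 δ with hc₂
  have hc₂0 : 0 ≤ c₂ := by rw [hc₂, constTwo]; positivity
  have hc₂2 : c₂ ^ 2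
      = 256 * (((K : ℝ) ^ 3 / 3 + (K : ℝ) ^ 2 / 2 + (K : ℝ) / 6) * (2 * (p + n)) * Λ) := by
    rw [hc₂, constTwo, mul_pow, Real.sq_sqrt (by positivity), ← hΛ]; norm_num
  set τ₂ := 4 / 5 * (σw * c₂ / (σu * √N * √K)) with hτ₂
  have hW := measure_norm_gt_le (P := P) (fun q : Fin N × Fin K => h.process_law q.1 q.2)
    h.process_indep hY (h.input_noise_indep.comp measurable_id measurable_fst)
    (X := fun ω => (inputMatrix fun i k => w i k ω) * R (Y ω)) (good := good)
    (c := fun s t z => inputCoeff s (R z *ᵥ t))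
    (fun s t q => measurable_inputCoeff s (hRmeas t) q)
    (fun s t ω => by
      rw [← Matrix.mulVec_mulVec]
      exact dotProduct_inputMatrix_mulVec s _ fun q => w q.1 q.2 ω)
    (v := 25 * K * σw ^ 2 / (σu ^ 2 * N)) (τ := τ₂) (ε := δ / 3)
    (fun s t hs ht ω hg => by
      have h1 := sum_norm_inputCoeff_le s (R (Y ω) *ᵥ t)
      rw [hs] at h1
      calc _ ≤ σw ^ 2 * (K * (vnorm (R (Y ω) *ᵥ t) ^ 2 * 1 ^ 2)) := by gcongr
        _ ≤ σw ^ 2 * (K * (25 / (σu ^ 2 * N) * 1 ^ 2)) := by gcongr; exact hRle ω hg t ht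
        _ = _ := by ring)
    (by positivity) (by positivity) (by
      have e : τ₂ ^ 2 / (2 * (25 * K * σw ^ 2 / (σu ^ 2 * N)))
          = 4096 / 625 * ((K / 3 + 1 / 2 + 1 / (6 * K)) * (p + n) * Λ) := by
        simp only [hτ₂, mul_pow, div_pow, hsN, hsK, hc₂2]
        field_simp
        norm_num
      rw [e]
      simp only [Fintype.card_prod, Fintype.card_fin, Nat.cast_mul]
      have h0 : 0 ≤ (1 / 2 + 1 / (6 * K) : ℝ) * (p + n) * Λ := by positivity
      nlinarith [hcmp n])
  set F := noiseMarkov K A C with hF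
  have hconst : markovError p K N A C σu σw σv δ
      = √K * (‖F‖ * (5 / 4 * τ₂) + 5 / 4 * τ₁) := by
    have e : constTwo n p K ‖F‖ δ = ‖F‖ * c₂ := by rw [hc₂, constTwo, constTwo]; ring
    rw [markovError, ← hF, e, ← hc₁, hτ₁, hτ₂, Real.sqrt_div zero_le_one, Real.sqrt_one]
    field_simp
    ring
  calc _ ≤ P ({ω | ¬ good ω} ∪
        ({ω | good ω ∧ ¬ ‖(outputMatrix fun i k => (v i k ω).ofLp) * R (Y ω)‖ ≤ 5 / 4 * τ₁} ∪
          {ω | good ω ∧ ¬ ‖(inputMatrix fun i k => w i k ω) * R (Y ω)‖ ≤ 5 / 4 * τ₂})) := by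
        refine measure_mono fun ω hω => ?_
        by_contra hcon
        simp only [Set.mem_union, Set.mem_ofPred_eq, not_or, not_not, not_and] at hcon
        obtain ⟨hg, h1, h2⟩ := hcon
        refine hω fun Ghat hls => ?_
        rw [IsLeastSquares.eq_add_mul_rightInv hαpos hg (h.outputMatrix_eq ω) hls, hconst,
          add_sub_cancel_left, Matrix.add_mul, Matrix.mul_assoc]
        gcongr
        refine (norm_add_le _ _).trans (add_le_add ?_ (h1 hg))
        exact (Matrix.l2_opNorm_mul _ _).trans (by gcongr; exact h2 hg)
    _ ≤ ENNReal.ofReal (δ / 3) + (ENNReal.ofReal (δ / 3) + ENNReal.ofReal (δ / 3)) :=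
        (measure_union_le _ _).trans (add_le_add hexc
          ((measure_union_le _ _).trans (add_le_add hV hW)))
    _ = ENNReal.ofReal δ := by
        rw [← ENNReal.ofReal_add (by positivity) (by positivity),
          ← ENNReal.ofReal_add (by positivity) (by positivity)]
        congr 1
        ring

end Estimation

/-! ### Estimation of the poles -/

section Poles

variable {n m p N K₁ K₂ : ℕ} {A : Matrix (Fin n) (Fin n) ℝ} {B : Matrix (Fin n) (Fin p) ℝ}
  {C : Matrix (Fin m) (Fin n) ℝ} {D : Matrix (Fin m) (Fin p) ℝ} {σu σw σv δ : ℝ}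

lemma IsControllable.one_le (hn : 0 < n) (h : IsControllable A B) : 1 ≤ p := by
  by_contra hp
  have hp0 : p = 0 := by omega
  subst hp0
  have := Matrix.rank_le_card_width
    (Matrix.of fun (a : Fin n) (kb : Fin n × Fin 0) => (A ^ (kb.1 : ℕ) * B) a kb.2)
  rw [h] at this
  simp at this
  omega

lemma markovError_eq (K : ℕ) (A : Matrix (Fin n) (Fin n) ℝ)
    (C : Matrix (Fin m) (Fin n) ℝ) (σu σw σv δ : ℝ) :
    markovError p K N A C σu σw σv δ = markovError p K 1 A C σu σw σv δ * √(1 / N) := by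
  simp [markovError]

lemma poleDelta_eq (A : Matrix (Fin n) (Fin n) ℝ) (B : Matrix (Fin n) (Fin p) ℝ)
    (C : Matrix (Fin m) (Fin n) ℝ) (D : Matrix (Fin m) (Fin p) ℝ) (σu σw σv δ : ℝ) :
    poleDelta K₁ K₂ N A B C D σu σw σv δ = poleDelta K₁ K₂ 1 A B C D σu σw σv δ * √(1 / N) := by
  rw [poleDelta, poleDelta, markovError_eq]
  ring

lemma markovError_nonneg (hσu : 0 < σu) (hσw : 0 < σw) (hσv : 0 < σv) (K : ℕ) :
    0 ≤ markovError p K N A C σu σw σv δ := by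
  unfold markovError constOne constTwo
  positivity

lemma exists_measurableSet_of_measure_not_le {Ω : Type*} [MeasurableSpace Ω] {P : Measure Ω}
    [IsProbabilityMeasure P] {Q : Ω → Prop} (hδ : 0 ≤ δ)
    (h : P {ω | ¬ Q ω} ≤ ENNReal.ofReal δ) :
    ∃ E : Set Ω, MeasurableSet E ∧ ENNReal.ofReal (1 - δ) ≤ P E ∧ ∀ ω ∈ E, Q ω := by
  refine ⟨(toMeasurable P {ω | ¬ Q ω})ᶜ, (measurableSet_toMeasurable P _).compl, ?_,
    fun ω hω => ?_⟩
  · rw [prob_compl_eq_one_sub (measurableSet_toMeasurable P _), measure_toMeasurable,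
      ENNReal.ofReal_sub _ hδ, ENNReal.ofReal_one]
    exact tsub_le_tsub_left h _
  · by_contra hQ
    exact hω (subset_toMeasurable P _ hQ)

/-- The finite-sample bound on the poles. -/
theorem IsExperiment.exists_event (hn : 0 < n) (hK₁ : n ≤ K₁) (hK₂ : n ≤ K₂)
    (hobs : IsObservable A C) (hctr : IsControllable A B) (hσu : 0 < σu) (hσw : 0 < σw)
    (hσv : 0 < σv) (hδ₀ : 0 < δ) (hδ₁ : δ < 1)
    {L : Matrix (Fin K₁ × Fin m) (Fin K₂ × Fin p) ℝ} {Abar : Matrix (Fin n) (Fin n) ℝ}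
    (hAbar : IsHoKalmanOutput (markov (K₁ + K₂ + 1) A B C D) L Abar)
    (hN : 8 * (p : ℝ) * ((K₁ + K₂ + 1 : ℕ) : ℝ) + 4 * ((p : ℝ) + n + m + 4) *
      Real.log (3 * ((K₁ + K₂ + 1 : ℕ) : ℝ) / δ) ≤ N)
    {Ω : Type*} [MeasurableSpace Ω] {P : Measure Ω} [IsProbabilityMeasure P]
    {u : Fin N → Fin (K₁ + K₂ + 1) → Ω → EuclideanSpace ℝ (Fin p)}
    {w : Fin N → Fin (K₁ + K₂ + 1) → Ω → EuclideanSpace ℝ (Fin n)}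
    {v : Fin N → Fin (K₁ + K₂ + 1) → Ω → EuclideanSpace ℝ (Fin m)}
    {x : Fin N → Fin (K₁ + K₂ + 1 + 1) → Ω → (Fin n → ℝ)}
    {y : Fin N → Fin (K₁ + K₂ + 1) → Ω → (Fin m → ℝ)}
    (h : IsExperiment P A B C D σu σw σv u w v x y) :
    ∃ E : Set Ω, MeasurableSet E ∧ ENNReal.ofReal (1 - δ) ≤ P E ∧
      ∀ ω ∈ E, ∀ Ghat : Matrix (Fin m) (Fin (K₁ + K₂ + 1) × Fin p) ℝ,
        IsLeastSquares (outputMatrix fun i k => y i k ω) (inputMatrix fun i k => u i k ω) Ghat →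
        ∀ (Lhat : Matrix (Fin K₁ × Fin m) (Fin K₂ × Fin p) ℝ) (Ahat : Matrix (Fin n) (Fin n) ℝ),
          IsHoKalmanOutput Ghat Lhat Ahat →
          (‖L - Lhat‖ ≤ sigma n (hankelMinus (markov (K₁ + K₂ + 1) A B C D)) / 2 ∨
            4 * √(min K₁ K₂ : ℕ) * markovError p (K₁ + K₂ + 1) N A C σu σw σv δ ≤
              sigma n (hankelMinus (markov (K₁ + K₂ + 1) A B C D))) →
          spectralDist Ahat Abar ≤
            (poleDelta K₁ K₂ N A B C D σu σw σv δ + 2 * ‖Abar‖) ^ (1 - 1 / (n : ℝ)) *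
              poleDelta K₁ K₂ N A B C D σu σw σv δ ^ (1 / (n : ℝ)) := by
  have hlog : 0 ≤ Real.log (3 * ((K₁ + K₂ + 1 : ℕ) : ℝ) / δ) := by
    refine Real.log_nonneg ?_
    rw [le_div_iff₀ hδ₀]
    push_cast
    have : (0 : ℝ) ≤ K₁ := Nat.cast_nonneg _
    have : (0 : ℝ) ≤ K₂ := Nat.cast_nonneg _
    linarith
  have hN' : 8 * (p : ℝ) * ((K₁ + K₂ + 1 : ℕ) : ℝ) +
      16 * Real.log (3 * ((K₁ + K₂ + 1 : ℕ) : ℝ) / δ) ≤ N := by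
    have : 0 ≤ ((p : ℝ) + n + m) * Real.log (3 * ((K₁ + K₂ + 1 : ℕ) : ℝ) / δ) := by positivity
    linarith
  have hbad := h.measure_estimation hσu hσw hσv hδ₀ hδ₁ (hctr.one_le hn) (by omega) hN'
  obtain ⟨E, hE, hPE, hEω⟩ := exists_measurableSet_of_measure_not_le hδ₀.le hbad
  refine ⟨E, hE, hPE, fun ω hω Ghat hls Lhat Ahat hAhat hcond => ?_⟩
  refine hoKalman_spectralDist_le hn hK₁ hK₂ hobs hctr hAbar hAhat
    (le_trans ?_ (hEω ω hω Ghat hls)) hcond rfl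
  gcongr
  omega

end Poles

end PoleEstimation

theorem mainTheorem3 {n m p K₁ K₂ : ℕ} (hn : 0 < n) (hK₁ : n ≤ K₁) (hK₂ : n ≤ K₂)
    (A : Matrix (Fin n) (Fin n) ℝ) (B : Matrix (Fin n) (Fin p) ℝ)
    (C : Matrix (Fin m) (Fin n) ℝ) (D : Matrix (Fin m) (Fin p) ℝ)
    (hobs : PoleEstimation.IsObservable A C) (hctr : PoleEstimation.IsControllable A B)
    (σu σw σv : ℝ) (hσu : 0 < σu) (hσw : 0 < σw) (hσv : 0 < σv)
    (δ : ℝ) (hδ₀ : 0 < δ) (hδ₁ : δ < 1)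
    -- the output of the Ho-Kalman algorithm on the true Markov parameters
    (L : Matrix (Fin K₁ × Fin m) (Fin K₂ × Fin p) ℝ) (Abar : Matrix (Fin n) (Fin n) ℝ)
    (hAbar : PoleEstimation.IsHoKalmanOutput
      (PoleEstimation.markov (K₁ + K₂ + 1) A B C D) L Abar) :
    -- the finite-sample bound
    (∀ N : ℕ,
      8 * (p : ℝ) * ((K₁ + K₂ + 1 : ℕ) : ℝ) + 4 * ((p : ℝ) + n + m + 4) *
        Real.log (3 * ((K₁ + K₂ + 1 : ℕ) : ℝ) / δ) ≤ N →
      ∀ (Ω : Type u) [MeasurableSpace Ω] (P : Measure Ω) [IsProbabilityMeasure P]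
        (u : Fin N → Fin (K₁ + K₂ + 1) → Ω → EuclideanSpace ℝ (Fin p))
        (w : Fin N → Fin (K₁ + K₂ + 1) → Ω → EuclideanSpace ℝ (Fin n))
        (v : Fin N → Fin (K₁ + K₂ + 1) → Ω → EuclideanSpace ℝ (Fin m))
        (x : Fin N → Fin (K₁ + K₂ + 1 + 1) → Ω → (Fin n → ℝ))
        (y : Fin N → Fin (K₁ + K₂ + 1) → Ω → (Fin m → ℝ)),
        PoleEstimation.IsExperiment P A B C D σu σw σv u w v x y →
        ∃ E : Set Ω, MeasurableSet E ∧ ENNReal.ofReal (1 - δ) ≤ P E ∧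
          ∀ ω ∈ E, ∀ Ghat : Matrix (Fin m) (Fin (K₁ + K₂ + 1) × Fin p) ℝ,
            PoleEstimation.IsLeastSquares
              (PoleEstimation.outputMatrix fun i k => y i k ω)
              (PoleEstimation.inputMatrix fun i k => u i k ω) Ghat →
            ∀ (Lhat : Matrix (Fin K₁ × Fin m) (Fin K₂ × Fin p) ℝ)
              (Ahat : Matrix (Fin n) (Fin n) ℝ),
              PoleEstimation.IsHoKalmanOutput Ghat Lhat Ahat →
              (‖L - Lhat‖ ≤ PoleEstimation.sigma n (PoleEstimation.hankelMinus
                  (PoleEstimation.markov (K₁ + K₂ + 1) A B C D)) / 2 ∨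
                4 * Real.sqrt (min K₁ K₂ : ℕ) *
                    PoleEstimation.markovError p (K₁ + K₂ + 1) N A C σu σw σv δ ≤
                  PoleEstimation.sigma n (PoleEstimation.hankelMinus
                    (PoleEstimation.markov (K₁ + K₂ + 1) A B C D))) →
              PoleEstimation.spectralDist Ahat Abar ≤
                (PoleEstimation.poleDelta K₁ K₂ N A B C D σu σw σv δ + 2 * ‖Abar‖) ^
                    (1 - 1 / (n : ℝ)) *
                  PoleEstimation.poleDelta K₁ K₂ N A B C D σu σw σv δ ^ (1 / (n : ℝ))) ∧
    -- the rate `O(N^{-1/(2n)})`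
    (∃ (c : ℝ) (N₀ : ℕ), ∀ N : ℕ, N₀ ≤ N →
      ∀ (Ω : Type u) [MeasurableSpace Ω] (P : Measure Ω) [IsProbabilityMeasure P]
        (u : Fin N → Fin (K₁ + K₂ + 1) → Ω → EuclideanSpace ℝ (Fin p))
        (w : Fin N → Fin (K₁ + K₂ + 1) → Ω → EuclideanSpace ℝ (Fin n))
        (v : Fin N → Fin (K₁ + K₂ + 1) → Ω → EuclideanSpace ℝ (Fin m))
        (x : Fin N → Fin (K₁ + K₂ + 1 + 1) → Ω → (Fin n → ℝ))
        (y : Fin N → Fin (K₁ + K₂ + 1) → Ω → (Fin m → ℝ)),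
        PoleEstimation.IsExperiment P A B C D σu σw σv u w v x y →
        ∃ E : Set Ω, MeasurableSet E ∧ ENNReal.ofReal (1 - δ) ≤ P E ∧
          ∀ ω ∈ E, ∀ Ghat : Matrix (Fin m) (Fin (K₁ + K₂ + 1) × Fin p) ℝ,
            PoleEstimation.IsLeastSquares
              (PoleEstimation.outputMatrix fun i k => y i k ω)
              (PoleEstimation.inputMatrix fun i k => u i k ω) Ghat →
            ∀ (Lhat : Matrix (Fin K₁ × Fin m) (Fin K₂ × Fin p) ℝ)
              (Ahat : Matrix (Fin n) (Fin n) ℝ),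
              PoleEstimation.IsHoKalmanOutput Ghat Lhat Ahat →
              PoleEstimation.spectralDist Ahat Abar ≤
                c * (N : ℝ) ^ (-(1 / (2 * (n : ℝ)))))  := by
  refine ⟨fun N hN Ω _ P _ u w v x y h => h.exists_event hn hK₁ hK₂ hobs hctr hσu hσw hσv hδ₀ hδ₁
    hAbar hN, ?_⟩
  set thr : ℝ := 8 * (p : ℝ) * ((K₁ + K₂ + 1 : ℕ) : ℝ) + 4 * ((p : ℝ) + n + m + 4) *
    Real.log (3 * ((K₁ + K₂ + 1 : ℕ) : ℝ) / δ) with hthr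
  set σ := PoleEstimation.sigma n (PoleEstimation.hankelMinus
    (PoleEstimation.markov (K₁ + K₂ + 1) A B C D)) with hσ
  have hσ0 : 0 < σ := PoleEstimation.sigma_pos_of_rank hn
    (PoleEstimation.rank_hankelMinus hK₁ hK₂ D hobs hctr)
  set ε := PoleEstimation.markovError p (K₁ + K₂ + 1) 1 A C σu σw σv δ with hε
  have hε0 : 0 ≤ ε := PoleEstimation.markovError_nonneg hσu hσw hσv _
  set κ := PoleEstimation.poleDelta K₁ K₂ 1 A B C D σu σw σv δ with hκ
  have hκ0 : 0 ≤ κ := by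
    rw [hκ, PoleEstimation.poleDelta]
    simp only [← hσ, ← hε]
    positivity
  refine ⟨(κ + 2 * ‖Abar‖) ^ (1 - 1 / (n : ℝ)) * κ ^ (1 / (n : ℝ)),
    max 1 (max ⌈thr⌉₊ ⌈(4 * √(min K₁ K₂ : ℕ) * ε / σ) ^ 2⌉₊),
    fun N hN Ω _ P _ u w v x y h => ?_⟩
  obtain ⟨hN1, hN2⟩ := max_le_iff.1 hN
  obtain ⟨hN2, hN3⟩ := max_le_iff.1 hN2
  have hNr : (1 : ℝ) ≤ N := by exact_mod_cast hN1
  have hcond : 4 * √(min K₁ K₂ : ℕ) *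
      PoleEstimation.markovError p (K₁ + K₂ + 1) N A C σu σw σv δ ≤ σ := by
    have h1 : 4 * √(min K₁ K₂ : ℕ) * ε / σ ≤ √N := Real.le_sqrt_of_sq_le (Nat.ceil_le.1 hN3)
    rw [div_le_iff₀ hσ0] at h1
    rw [PoleEstimation.markovError_eq, ← hε, Real.sqrt_div zero_le_one, Real.sqrt_one,
      ← mul_assoc, mul_one_div, div_le_iff₀ (Real.sqrt_pos.2 (by linarith))]
    linarith
  obtain ⟨E, hE, hPE, hEω⟩ := h.exists_event hn hK₁ hK₂ hobs hctr hσu hσw hσv hδ₀ hδ₁ hAbar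
    (Nat.ceil_le.1 hN2)
  refine ⟨E, hE, hPE, fun ω hω Ghat hls Lhat Ahat hAhat =>
    (hEω ω hω Ghat hls Lhat Ahat hAhat (Or.inr hcond)).trans ?_⟩
  have hr1 : √(1 / (N : ℝ)) ≤ 1 := by
    exact Real.sqrt_le_one.2 (div_le_one_of_le₀ hNr (by linarith))
  have hrpow : √(1 / (N : ℝ)) ^ (1 / (n : ℝ)) = (N : ℝ) ^ (-(1 / (2 * (n : ℝ)))) := by
    rw [Real.sqrt_eq_rpow, one_div (N : ℝ), Real.inv_rpow (by linarith),
      ← Real.rpow_neg (by linarith), ← Real.rpow_mul (by linarith)]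
    congr 1
    field_simp
  have hexp : 0 ≤ 1 - 1 / (n : ℝ) := by
    rw [sub_nonneg]
    exact div_le_one_of_le₀ (by exact_mod_cast hn) (Nat.cast_nonneg n)
  rw [PoleEstimation.poleDelta_eq, ← hκ, Real.mul_rpow hκ0 (Real.sqrt_nonneg _), hrpow, ← mul_assoc]
  gcongr
  exact mul_le_of_le_one_right hκ0 hr1
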